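/- **Setting.** A network has finite sets $\mathcal N$ of routers, $\mathcal B$ of base stations and $\mathcal U$ of users, a finite set $\mathcal L^{w}$ of directed wired links between nodes of $\mathcal N\cup\mathcal B$ with capacities $C_l\ge 0$, a finite set $\mathcal L^{wl}\subseteq\mathcal B\times\mathcal U\times\{1,\dots,K\}$ of wireless links $(s,d,k)$ (from $s$ to $d$ on tone $k$), and $M\ge 1$ commodities with source $S(m)$ and destination $D(m)\neq S(m)$. Let $\mathcal L=\mathcal L^w\cup\mathcal L^{wl}$, let $h_{ds}^k\in\mathbb C$ be the channels, $\sigma_d^2>0$ the noise variances and $\bar p_s\ge 0$ the power budgets. For $l=(s,d,k)\in\mathcal L^{wl}$ put $I(l)=\{(s',d',k)\in\mathcal L^{wl}: h_{ds'}^k\ne 0\}$ and, for precoders $\mathbf p=(p_{ds}^k)$, $p_{ds}^k\in\mathbb C$, $$\bar r_l(\mathbf p)=\log\Big(1+\frac{|h_{ds}^k|^2|p_{ds}^k|^2}{\sum_{(s',d',k)\in I(l)\setminus\{l\}}|h_{ds'}^k|^2|p_{d's'}^k|^2+\sigma_d^2}\Big).$$ With $\mathbf r=(r,(r_m)_m,(r_l(m))_{l,m})$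 real, the *main problem* is to maximize $r$ over $(\mathbf r,\mathbf p)$ subject to $r\ge 0$, $r_m\ge r$, $r_l(m)\ge 0$; $\sum_m r_l(m)\le C_l$ for $l\in\mathcal L^w$; $\sum_m r_l(m)\le\bar r_l(\mathbf p)$ for $l\in\mathcal L^{wl}$; $\sum_{k,d:(s,d,k)\in\mathcal L^{wl}}|p_{ds}^k|^2\le\bar p_s$ for $s\in\mathcal B$; and flow conservation $$\sum_{l\in \mathrm{In}(v)}r_l(m)+1_{\{S(m)\}}(v)\,r_m=\sum_{l\in \mathrm{Out}(v)}r_l(m)+1_{\{D(m)\}}(v)\,r_m$$ for all nodes $v$ and all $m$, where $\mathrm{In}(v)$ and $\mathrm{Out}(v)$ are the links ending and starting at $v$. The *rate-MSE reformulation* has additional variables $u_l\in\mathbb C$, $w_l>0$ ($l\in\mathcal L^{wl}$), the same objective $r$ and the same constraints, except that $\bar r_l(\mathbf p)$ is replaced by $$E_l(u_l,w_l,\mathbf p)=1+\log w_l-w_l(1+\sigma_d^2|u_l|^2)+2w_l\,\mathrm{Re}(u_l^*h_{ds}^kp_{ds}^k)-\sum_{(s',d',k)\in I(l)}w_l|u_l|^2|h_{ds'}^k|^2|p_{d's'}^k|^2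 .$$ Put $$u_l(\mathbf p)=\Big(\sum_{(s',d',k)\in I(l)}|h_{ds'}^k|^2|p_{d's'}^k|^2+\sigma_d^2\Big)^{-1}h_{ds}^kp_{ds}^k,\qquad w_l(\mathbf p)=\big(1-(h_{ds}^kp_{ds}^k)^*u_l(\mathbf p)\big)^{-1}.$$ The *N-MaxMin algorithm* starts at any feasible point $(\mathbf r^{(0)},\mathbf p^{(0)})$ of the main problem; for $t\ge 1$ it sets $\mathbf u^{(t)}=\mathbf u(\mathbf p^{(t-1)})$, $\mathbf w^{(t)}=\mathbf w(\mathbf p^{(t-1)})$ and takes for $(\mathbf r^{(t)},\mathbf p^{(t)})$ any optimal solution of the convex problem obtained from the rate-MSE reformulation by fixing $\mathbf u=\mathbf u^{(t)}$, $\mathbf w=\mathbf w^{(t)}$. A *stationary point* of the main problem is a point satisfying its Karush–Kuhn–Tucker conditions (with derivatives in the real and imaginary parts of $\mathbf p$). **Theorem.** (a) For every sequence $(\mathbf r^{(t)},\mathbf p^{(t)})_{t\ge 0}$ generated by the N-MaxMin algorithm, the sequence is bounded, the objective values $r^{(t)}$ converge, every limit point of the sequence is a stationary point of the main problem, and the distance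 of $(\mathbf r^{(t)},\mathbf p^{(t)})$ to the set of stationary points of the main problem tends to $0$. (b) If $(\mathbf r,\mathbf p)$ is a global optimal solution of the main problem, then $(\mathbf r,\mathbf p,\mathbf u(\mathbf p),\mathbf w(\mathbf p))$ is a global optimal solution of the rate-MSE reformulation. Conversely, if $(\mathbf r,\mathbf p,\mathbf u,\mathbf w)$ is a global optimal solution of the reformulation, then $(\mathbf r,\mathbf p)$ is a global optimal solution of the main problem. Both problems attain their maximum, and the optimal values are equal. -/

import Mathlib

/-- The nodes of the network: routers `R`, base stations `B` and mobile users `U`. -/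
abbrev Node (R B U : Type*) := R ⊕ B ⊕ U

/-- A heterogeneous network with routers `R`, base stations `B`, mobile users `U`,
`K` frequency tones and `M` commodities. -/
structure HetNet (R B U : Type*) (K M : ℕ) where
  /-- the directed wired links, between routers and base stations -/
  wired : Finset ((R ⊕ B) × (R ⊕ B))
  /-- the wireless links `(s, d, k)`: from base station `s` to user `d` on tone `k` -/
  wireless : Finset (B × U × Fin K)
  /-- the capacity of a wired link -/
  cap : (R ⊕ B) × (R ⊕ B) → ℝ
  cap_nonneg : ∀ l ∈ wired, 0 ≤ cap l
  /-- `h d s k` is the channel tap from base station `s` to user `d` on tone `k` -/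
  h : U → B → Fin K → ℂ
  /-- the noise variance `σ_d ^ 2` at user `d` -/
  noise : U → ℝ
  noise_pos : ∀ d, 0 < noise d
  /-- the power budget of a base station -/
  power : B → ℝ
  power_nonneg : ∀ s, 0 ≤ power s
  /-- the source node of a commodity -/
  S : Fin M → Node R B U
  /-- the destination node of a commodity -/
  D : Fin M → Node R B U
  S_ne_D : ∀ m, S m ≠ D m

namespace HetNet

variable {R B U : Type*} {K M : ℕ}

abbrev WiredLink (N : HetNet R B U K M) := {l // l ∈ N.wired}

abbrev WirelessLink (N : HetNet R B U K M) := {l // l ∈ N.wireless}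

/-- All directed links. -/
abbrev Link (N : HetNet R B U K M) := N.WiredLink ⊕ N.WirelessLink

/-- The base station of a wireless link. -/
def bs {N : HetNet R B U K M} (l : N.WirelessLink) : B := l.1.1

/-- The user of a wireless link. -/
def user {N : HetNet R B U K M} (l : N.WirelessLink) : U := l.1.2.1

/-- The tone of a wireless link. -/
def tone {N : HetNet R B U K M} (l : N.WirelessLink) : Fin K := l.1.2.2

/-- Routers and base stations as nodes. -/
def backhaulNode : R ⊕ B → Node R B U
  | Sum.inl a => Sum.inl a
  | Sum.inr b => Sum.inr (Sum.inl b)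

/-- The node at which a link starts. -/
def src (N : HetNet R B U K M) : N.Link → Node R B U
  | Sum.inl l => backhaulNode l.1.1
  | Sum.inr l => Sum.inr (Sum.inl (bs l))

/-- The node at which a link ends. -/
def dst (N : HetNet R B U K M) : N.Link → Node R B U
  | Sum.inl l => backhaulNode l.1.2
  | Sum.inr l => Sum.inr (Sum.inr (user l))

/-- The optimization variables `(𝐫, 𝐩)`, that is the tuple `(r, (r_m), (r_l(m)), (p_l))`: the
minimum rate, the commodity rates, the flow rates on the links, and the complex precoders. It is a
finite-dimensional real normed space. -/
abbrev Var (N : HetNet R B U K M) :=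
  ℝ × (Fin M → ℝ) × (N.Link → Fin M → ℝ) × (N.WirelessLink → ℂ)

def minRate {N : HetNet R B U K M} (x : N.Var) : ℝ := x.1

def commRate {N : HetNet R B U K M} (x : N.Var) : Fin M → ℝ := x.2.1

def flow {N : HetNet R B U K M} (x : N.Var) : N.Link → Fin M → ℝ := x.2.2.1

def precoder {N : HetNet R B U K M} (x : N.Var) : N.WirelessLink → ℂ := x.2.2.2

/-- The total flow rate on a link. -/
def load {N : HetNet R B U K M} (x : N.Var) (l : N.Link) : ℝ := ∑ m, flow x l m

/-- The channel from the base station of the wireless link `n` to the user of the wireless link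
`l`, on the tone of `l`. -/
def chan (N : HetNet R B U K M) (l n : N.WirelessLink) : ℂ := N.h (user l) (bs n) (tone l)

open Classical in
/-- The set `I(l)` of links interfering with `l`: the wireless links on the same tone whose base
station has a nonzero channel to the user of `l`. -/
noncomputable def interferers (N : HetNet R B U K M) (l : N.WirelessLink) :
    Finset N.WirelessLink :=
  Finset.univ.filter fun n => tone n = tone l ∧ N.chan l n ≠ 0

open Classical in
/-- The achievable rate `r̄_l(𝐩)` of a wireless link. -/
noncomputable def rate (N : HetNet R B U K M) (p : N.WirelessLink → ℂ) (l : N.WirelessLink) : ℝ :=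
  Real.log (1 + ‖N.chan l l‖ ^ 2 * ‖p l‖ ^ 2 /
    (∑ n ∈ N.interferers l \ {l}, ‖N.chan l n‖ ^ 2 * ‖p n‖ ^ 2 + N.noise (user l)))

/-- The right-hand side `E_l(u_l, w_l, 𝐩)` of the rate-MSE constraint. -/
noncomputable def rateMSE (N : HetNet R B U K M) (u : N.WirelessLink → ℂ) (w : N.WirelessLink → ℝ)
    (p : N.WirelessLink → ℂ) (l : N.WirelessLink) : ℝ :=
  1 + Real.log (w l) - w l * (1 + N.noise (user l) * ‖u l‖ ^ 2)
    + 2 * w l * (star (u l) * N.chan l l * p l).re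
    - ∑ n ∈ N.interferers l, w l * ‖u l‖ ^ 2 * ‖N.chan l n‖ ^ 2 * ‖p n‖ ^ 2

open Classical in
/-- The power spent by base station `s`. -/
noncomputable def usedPower (N : HetNet R B U K M) (p : N.WirelessLink → ℂ) (s : B) : ℝ :=
  ∑ l : N.WirelessLink with bs l = s, ‖p l‖ ^ 2

open Classical in
/-- Incoming flow of commodity `m` at node `v`, including what the source injects. -/
noncomputable def inflow (N : HetNet R B U K M) (x : N.Var) (v : Node R B U) (m : Fin M) : ℝ :=
  (∑ l : N.Link with N.dst l = v, flow x l m) + (if v = N.S m then commRate x m else 0)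

open Classical in
/-- Outgoing flow of commodity `m` at node `v`, including what the destination absorbs. -/
noncomputable def outflow (N : HetNet R B U K M) (x : N.Var) (v : Node R B U) (m : Fin M) : ℝ :=
  (∑ l : N.Link with N.src l = v, flow x l m) + (if v = N.D m then commRate x m else 0)

/-- The constraints other than the capacity constraints of the wireless links. -/
structure BaseFeasible (N : HetNet R B U K M) (x : N.Var) : Prop where
  minRate_nonneg : 0 ≤ minRate x
  minRate_le : ∀ m, minRate x ≤ commRate x m
  flow_nonneg : ∀ l m, 0 ≤ flow x l m
  wired_cap : ∀ l : N.WiredLink, load x (Sum.inl l) ≤ N.cap l.1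
  power_le : ∀ s, N.usedPower (precoder x) s ≤ N.power s
  conservation : ∀ v m, N.inflow x v m = N.outflow x v m

/-- The feasible set of the joint routing and precoding problem. -/
def mainFeasible (N : HetNet R B U K M) : Set N.Var :=
  {x | N.BaseFeasible x ∧ ∀ l : N.WirelessLink, load x (Sum.inr l) ≤ N.rate (precoder x) l}

/-- `x` is a global optimal solution of the joint routing and precoding problem. -/
def IsMainOptimal (N : HetNet R B U K M) (x : N.Var) : Prop :=
  x ∈ N.mainFeasible ∧ IsMaxOn minRate N.mainFeasible x

/-- The feasible set, in `(𝐫, 𝐩)`, of the rate-MSE reformulation when `𝐮` and `𝐰` are fixed. -/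
def subFeasible (N : HetNet R B U K M) (u : N.WirelessLink → ℂ) (w : N.WirelessLink → ℝ) :
    Set N.Var :=
  {x | N.BaseFeasible x ∧
    ∀ l : N.WirelessLink, load x (Sum.inr l) ≤ N.rateMSE u w (precoder x) l}

/-- The variables `(𝐫, 𝐩, 𝐮, 𝐰)` of the rate-MSE reformulation. -/
abbrev VarMSE (N : HetNet R B U K M) :=
  N.Var × (N.WirelessLink → ℂ) × (N.WirelessLink → ℝ)

/-- The feasible set of the rate-MSE reformulation; `0 < w_l` is the domain of `log w_l`. -/
def mseFeasible (N : HetNet R B U K M) : Set N.VarMSE :=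
  {z | (∀ l, 0 < z.2.2 l) ∧ z.1 ∈ N.subFeasible z.2.1 z.2.2}

/-- The objective of the rate-MSE reformulation. -/
def mseObjective {N : HetNet R B U K M} (z : N.VarMSE) : ℝ := minRate z.1

/-- `z` is a global optimal solution of the rate-MSE reformulation. -/
def IsMSEOptimal (N : HetNet R B U K M) (z : N.VarMSE) : Prop :=
  z ∈ N.mseFeasible ∧ IsMaxOn mseObjective N.mseFeasible z

/-- The closed-form update of `𝐮`. -/
noncomputable def updateU (N : HetNet R B U K M) (p : N.WirelessLink → ℂ) :
    N.WirelessLink → ℂ := fun l =>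
  ((∑ n ∈ N.interferers l, ‖N.chan l n‖ ^ 2 * ‖p n‖ ^ 2 + N.noise (user l) : ℝ) : ℂ)⁻¹
    * (N.chan l l * p l)

/-- The closed-form update of `𝐰`. For `u = N.updateU p` the complex number of which the real part
is taken is already real. -/
noncomputable def updateW (N : HetNet R B U K M) (p u : N.WirelessLink → ℂ) :
    N.WirelessLink → ℝ := fun l => ((1 - star (N.chan l l * p l) * u l)⁻¹).re

/-- `(x, u, w)` is a sequence of iterates of the N-MaxMin algorithm: it starts at a feasible point
`x 0`, and the step `t + 1` updates `𝐮`, then `𝐰`, in closed form, and then takes for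
`(𝐫, 𝐩)` an optimal solution (any one, if there are several) of the convex problem that results
from fixing `𝐮` and `𝐰`. -/
structure IsNMaxMinRun (N : HetNet R B U K M) (x : ℕ → N.Var) (u : ℕ → N.WirelessLink → ℂ)
    (w : ℕ → N.WirelessLink → ℝ) : Prop where
  init : x 0 ∈ N.mainFeasible
  u_step : ∀ t, u (t + 1) = N.updateU (precoder (x t))
  w_step : ∀ t, w (t + 1) = N.updateW (precoder (x t)) (u (t + 1))
  x_feasible : ∀ t, x (t + 1) ∈ N.subFeasible (u (t + 1)) (w (t + 1))
  x_optimal : ∀ t, IsMaxOn minRate (N.subFeasible (u (t + 1)) (w (t + 1))) (x (t + 1))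

/-- Lagrange multipliers of the joint routing and precoding problem: `δ`, `δc`, `δf` for
`r ≥ 0`, `r_m ≥ r`, `r_l(m) ≥ 0`, then `θ` for the link capacities, `ε` for the power budgets and
`κ` for flow conservation. -/
structure Multipliers (N : HetNet R B U K M) where
  δ : ℝ
  δc : Fin M → ℝ
  δf : N.Link → Fin M → ℝ
  θ : N.Link → ℝ
  ε : B → ℝ
  κ : Node R B U → Fin M → ℝ

/-- The capacity of a link, wired or wireless, for given precoders. -/
noncomputable def linkCap (N : HetNet R B U K M) (p : N.WirelessLink → ℂ) : N.Link → ℝ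
  | Sum.inl l => N.cap l.1
  | Sum.inr l => N.rate p l

/-- The Lagrangian of the joint routing and precoding problem. -/
noncomputable def lagrangian [Fintype R] [Fintype B] [Fintype U] (N : HetNet R B U K M)
    (μ : N.Multipliers) (x : N.Var) : ℝ :=
  minRate x + μ.δ * minRate x + ∑ m, μ.δc m * (commRate x m - minRate x)
    + ∑ l, ∑ m, μ.δf l m * flow x l m
    + ∑ l, μ.θ l * (N.linkCap (precoder x) l - load x l)
    + ∑ s, μ.ε s * (N.power s - N.usedPower (precoder x) s)
    + ∑ v, ∑ m, μ.κ v m * (N.inflow x v m - N.outflow x v m)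

/-- `x` is a stationary point (KKT point) of the joint routing and precoding problem: it is
feasible, and there are multipliers, nonnegative for the inequalities and complementary to them,
for which the derivative of the Lagrangian in the real vector space of all variables vanishes
at `x`. -/
def IsKKT [Fintype R] [Fintype B] [Fintype U] (N : HetNet R B U K M) (x : N.Var) : Prop :=
  x ∈ N.mainFeasible ∧ ∃ μ : N.Multipliers,
    (0 ≤ μ.δ ∧ (∀ m, 0 ≤ μ.δc m) ∧ (∀ l m, 0 ≤ μ.δf l m) ∧ (∀ l, 0 ≤ μ.θ l) ∧ ∀ s, 0 ≤ μ.ε s) ∧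
    (μ.δ * minRate x = 0 ∧ (∀ m, μ.δc m * (commRate x m - minRate x) = 0) ∧
      (∀ l m, μ.δf l m * flow x l m = 0) ∧
      (∀ l, μ.θ l * (N.linkCap (precoder x) l - load x l) = 0) ∧
      ∀ s, μ.ε s * (N.power s - N.usedPower (precoder x) s) = 0) ∧
    HasFDerivAt (N.lagrangian μ) (0 : N.Var →L[ℝ] ℝ) x

end HetNet

/-! For fixed precoders, the largest value of `rateMSE` over `u` and `w > 0` is `rate`, attained at
the closed-form updates: completing a square minimizes the mean square error over `u`, and `log t ≤
t - 1` settles `w` (`rateMSE_le_rate`, `rateMSE_update`). Hence feasible points of either problem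
yield feasible points of the other with the same objective value, which is part (b); attainment
comes from compactness of `mainFeasible`.

For part (a), the algorithm is minorization-maximization: each subproblem is an inner approximation
of the main problem, and the current iterate is feasible for it. So the iterates stay in a compact
set and their objective values increase to a limit.

Suppose that a limit point `y` is not stationary. By Farkas' lemma the problem linearized at `y` has
a direction of increase. A minorant that touches the rate at `y` is tangent to it there, so this is
also the linearization of the subproblem given by `y`. Bending the direction slightly towards a
shrinking of `y` makes it strict for the power budgets and for the links that carry a signal, and a
short move gives a better point `x` (`exists_improves`). If `x` has a counterpart with equal
objective in the subproblems of all iterates near `y`, some iterate exceeds the limit of the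
objective values, a contradiction (`isKKT_of_mapClusterPt`).

The delicate links are those without signal at `y`. Their minorant at `y` is identically zero, so no
Slater point exists, and for a nearby iterate `q` with `q l` small but nonzero the minorant can be
negative at `x`. Such links carry no load in `x`, and it suffices to add to `x` a precoder of fixed
small modulus in the phase of `q l`: the gain is of first order in `‖q l‖`, the loss of second order
(`rateMSE_update_nonneg`). -/

/-! ### Farkas' lemma and Lagrange multipliers -/

/-- **Farkas' lemma**: a linear functional that is nonnegative on a polyhedral cone is a
nonnegative combination of the functionals that define the cone. -/
theorem Module.Dual.exists_eq_sum_smul_of_nonneg {ι V : Type*} [AddCommGroup V] [Module ℝ V]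
    (s : Finset ι) (a : ι → Module.Dual ℝ V) (f : Module.Dual ℝ V)
    (h : ∀ d, (∀ i ∈ s, 0 ≤ a i d) → 0 ≤ f d) :
    ∃ c : ι → ℝ, (∀ i, 0 ≤ c i) ∧ f = ∑ i ∈ s, c i • a i := by
  classical
  induction s using Finset.induction_on generalizing a f with
  | empty =>
    refine ⟨0, fun _ => le_rfl, ?_⟩
    ext d
    have h1 := h d (by simp)
    have h2 := h (-d) (by simp)
    simp only [map_neg] at h2
    simp only [Finset.sum_empty, LinearMap.zero_apply]
    linarith
  | insert j s hj ih =>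
    by_cases hs : ∀ d, (∀ i ∈ s, 0 ≤ a i d) → 0 ≤ f d
    · obtain ⟨c, hc, hf⟩ := ih a f hs
      refine ⟨Function.update c j 0, fun i => ?_, ?_⟩
      · rcases eq_or_ne i j with rfl | hi
        · simp
        · simp [hi, hc]
      · rw [Finset.sum_insert hj, hf]
        simp only [Function.update_self, zero_smul, zero_add]
        refine Finset.sum_congr rfl fun i hi => ?_
        rw [Function.update_of_ne (ne_of_mem_of_not_mem hi hj)]
    · push Not at hs
      obtain ⟨d₁, hd₁, hfd₁⟩ := hs
      have hjd₁ : a j d₁ < 0 := by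
        by_contra! hcon
        exact absurd (h d₁ (by simpa using ⟨hcon, hd₁⟩)) (not_le.2 hfd₁)
      obtain ⟨d₀, hjd, hd, hfd⟩ : ∃ d₀, a j d₀ = -1 ∧ (∀ i ∈ s, 0 ≤ a i d₀) ∧ f d₀ < 0 := by
        have hpos : 0 < (-a j d₁)⁻¹ := inv_pos.2 (by linarith)
        refine ⟨(-a j d₁)⁻¹ • d₁, ?_, fun i hi => ?_, ?_⟩
        · rw [map_smul, smul_eq_mul, inv_neg, neg_mul, inv_mul_cancel₀ hjd₁.ne]
        · rw [map_smul]
          exact mul_nonneg hpos.le (hd₁ i hi)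
        · rw [map_smul]
          exact mul_neg_of_pos_of_neg hpos hfd₁
      -- The map `x ↦ x + a j x • d₀` projects onto the kernel of `a j`. The induction hypothesis is
      -- applied to all functionals composed with this projection; expanding the result leaves `a j`
      -- with the coefficient `∑ c i * a i d₀ - f d₀`, a difference of a nonnegative and a negative
      -- number.
      obtain ⟨c, hc, hf⟩ := ih (fun i => a i + a i d₀ • a j) (f + f d₀ • a j) (by
        intro x hx
        have := h (x + a j x • d₀) (by
          intro i hi
          rcases Finset.mem_insert.1 hi with rfl | hi
          · simp [hjd]
          · have := hx i hi
            simp only [LinearMap.add_apply, LinearMap.smul_apply, smul_eq_mul] at this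
            simp only [map_add, map_smul, smul_eq_mul]
            linarith)
        simp only [map_add, map_smul, smul_eq_mul] at this
        simp only [LinearMap.add_apply, LinearMap.smul_apply, smul_eq_mul]
        linarith)
      have hcj : 0 ≤ ∑ i ∈ s, c i * a i d₀ - f d₀ := by
        have := Finset.sum_nonneg fun i hi => mul_nonneg (hc i) (hd i hi)
        linarith
      refine ⟨Function.update c j (∑ i ∈ s, c i * a i d₀ - f d₀), fun i => ?_, ?_⟩
      · rcases eq_or_ne i j with rfl | hi
        · simpa using hcj
        · simp [hi, hc]
      · rw [Finset.sum_insert hj, Function.update_self]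
        have : ∑ i ∈ s, Function.update c j (∑ i ∈ s, c i * a i d₀ - f d₀) i • a i
            = ∑ i ∈ s, c i • a i :=
          Finset.sum_congr rfl fun i hi => by
            rw [Function.update_of_ne (ne_of_mem_of_not_mem hi hj)]
        rw [this]
        ext x
        have hx := LinearMap.congr_fun hf x
        simp only [LinearMap.add_apply, LinearMap.smul_apply, smul_eq_mul, LinearMap.sum_apply,
          mul_add, Finset.sum_add_distrib] at hx ⊢
        have : ∑ i ∈ s, c i * (a i d₀ * a j x) = (∑ i ∈ s, c i * a i d₀) * a j x := by
          rw [Finset.sum_mul]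
          exact Finset.sum_congr rfl fun i _ => by ring
        linarith

/-- Either there are Lagrange multipliers for the objective `f`, the inequalities `0 ≤ a i` with
`i ∈ s`, and the equalities `b j = 0`, or the linearized problem has a direction of increase. -/
theorem exists_multipliers_or_direction {ι κ V : Type*} [Fintype κ] [NormedAddCommGroup V]
    [NormedSpace ℝ V] (s : Finset ι) (a : ι → V →L[ℝ] ℝ) (b : κ → V →L[ℝ] ℝ) (f : V →L[ℝ] ℝ) :
    (∃ (c : ι → ℝ) (e : κ → ℝ), (∀ i, 0 ≤ c i) ∧
      f + ∑ i ∈ s, c i • a i + ∑ j, e j • b j = 0) ∨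
    ∃ d, 0 < f d ∧ (∀ i ∈ s, 0 ≤ a i d) ∧ ∀ j, b j d = 0 := by
  classical
  by_cases h : ∃ d, 0 < f d ∧ (∀ i ∈ s, 0 ≤ a i d) ∧ ∀ j, b j d = 0
  · exact Or.inr h
  left
  push Not at h
  -- Farkas' lemma for `-f`, with each equality split into the two inequalities `0 ≤ b j` and `0 ≤
  -- -b j`; the difference of their coefficients is a multiplier of arbitrary sign.
  obtain ⟨c, hc, hf⟩ := Module.Dual.exists_eq_sum_smul_of_nonneg
    (s.disjSum (Finset.univ : Finset (κ ⊕ κ)))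
    (Sum.elim (fun i => (a i : V →ₗ[ℝ] ℝ))
      (Sum.elim (fun j => (b j : V →ₗ[ℝ] ℝ)) (fun j => -(b j : V →ₗ[ℝ] ℝ))))
    (-(f : V →ₗ[ℝ] ℝ)) (by
      intro d hd
      have h1 : ∀ i ∈ s, 0 ≤ a i d := fun i hi => hd (Sum.inl i) (by simpa using hi)
      have h2 : ∀ j, 0 ≤ b j d := fun j => hd (Sum.inr (Sum.inl j)) (by simp)
      have h3 : ∀ j, 0 ≤ -b j d := fun j => hd (Sum.inr (Sum.inr j)) (by simp)
      have h4 : ¬ 0 < f d := fun hfd => by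
        obtain ⟨j, hj⟩ := h d hfd h1
        exact hj (le_antisymm (by linarith [h3 j]) (h2 j))
      simpa using h4)
  refine ⟨fun i => c (Sum.inl i), fun j => c (Sum.inr (Sum.inl j)) - c (Sum.inr (Sum.inr j)),
    fun i => hc _, ?_⟩
  ext d
  have hd := LinearMap.congr_fun hf d
  simp only [Finset.sum_disjSum, Sum.elim_inl, Sum.elim_inr, Fintype.sum_sum_type,
    LinearMap.add_apply, LinearMap.neg_apply, LinearMap.sum_apply, LinearMap.smul_apply,
    ContinuousLinearMap.coe_coe, smul_eq_mul, mul_neg, Finset.sum_neg_distrib] at hd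
  simp only [add_apply, _root_.sum_apply, smul_apply, smul_eq_mul, zero_apply,
    sub_mul, Finset.sum_sub_distrib]
  linarith

namespace HetNet

variable {R B U : Type*} {K M : ℕ}

/-- The power received at the user of the wireless link `l`, including the noise. -/
noncomputable def received (N : HetNet R B U K M) (p : N.WirelessLink → ℂ) (l : N.WirelessLink) :
    ℝ :=
  ∑ n ∈ N.interferers l, ‖N.chan l n‖ ^ 2 * ‖p n‖ ^ 2 + N.noise (user l)

open Classical in
/-- The power of noise and interference at the user of the wireless link `l`. -/
noncomputable def disturbance (N : HetNet R B U K M) (p : N.WirelessLink → ℂ)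
    (l : N.WirelessLink) : ℝ :=
  ∑ n ∈ N.interferers l \ {l}, ‖N.chan l n‖ ^ 2 * ‖p n‖ ^ 2 + N.noise (user l)

/-- The power of the useful signal of the wireless link `l` at its user. -/
noncomputable def signal (N : HetNet R B U K M) (p : N.WirelessLink → ℂ) (l : N.WirelessLink) :
    ℝ :=
  ‖N.chan l l‖ ^ 2 * ‖p l‖ ^ 2

/-! ### Rate and mean square error of a single link -/

section Pointwise

variable (N : HetNet R B U K M) (p q : N.WirelessLink → ℂ) (l : N.WirelessLink)

lemma signal_nonneg : 0 ≤ N.signal p l := by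
  unfold signal
  positivity

lemma noise_le_disturbance : N.noise (user l) ≤ N.disturbance p l := by
  classical
  have : 0 ≤ ∑ n ∈ N.interferers l \ {l}, ‖N.chan l n‖ ^ 2 * ‖p n‖ ^ 2 :=
    Finset.sum_nonneg fun _ _ => by positivity
  unfold disturbance
  linarith

lemma disturbance_pos : 0 < N.disturbance p l :=
  (N.noise_pos _).trans_le (N.noise_le_disturbance p l)

lemma received_eq : N.received p l = N.signal p l + N.disturbance p l := by
  classical
  unfold received disturbance signal
  by_cases h : l ∈ N.interferers l
  · rw [← Finset.sum_sdiff (Finset.singleton_subset_iff.2 h), Finset.sum_singleton]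
    ring
  -- A link is absent from its own set of interferers only if its direct channel vanishes, and then
  -- its signal is zero.
  · have : N.chan l l = 0 := by
      by_contra hc
      exact h (by simp [interferers, hc])
    rw [Finset.sdiff_eq_self_of_disjoint (Finset.disjoint_singleton_right.2 h)]
    simp [this]

lemma received_pos : 0 < N.received p l := by
  rw [received_eq]
  linarith [N.signal_nonneg p l, N.disturbance_pos p l]

lemma rate_eq : N.rate p l = Real.log (N.received p l / N.disturbance p l) := by
  rw [received_eq, add_div, div_self (N.disturbance_pos p l).ne', add_comm]
  rfl

lemma rate_nonneg : 0 ≤ N.rate p l := by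
  rw [rate_eq]
  refine Real.log_nonneg ?_
  rw [le_div_iff₀ (N.disturbance_pos p l), received_eq]
  linarith [N.signal_nonneg p l]

lemma rate_pos (h : N.chan l l * p l ≠ 0) : 0 < N.rate p l := by
  rw [rate_eq]
  refine Real.log_pos ?_
  rw [lt_div_iff₀ (N.disturbance_pos p l), received_eq]
  have : 0 < N.signal p l := by
    have h1 := left_ne_zero_of_mul h
    have h2 := right_ne_zero_of_mul h
    unfold signal
    positivity
  linarith

lemma rate_eq_zero (h : N.chan l l * p l = 0) : N.rate p l = 0 := by
  have : N.signal p l = 0 := by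
    unfold signal
    rcases mul_eq_zero.1 h with h | h <;> simp [h]
  rw [rate_eq, received_eq, this, zero_add, div_self (N.disturbance_pos p l).ne', Real.log_one]

lemma rateMSE_eq (u : N.WirelessLink → ℂ) (w : N.WirelessLink → ℝ) :
    N.rateMSE u w p l = 1 + Real.log (w l)
      - w l * (1 - 2 * (star (u l) * (N.chan l l * p l)).re + ‖u l‖ ^ 2 * N.received p l) := by
  unfold rateMSE received
  simp only [mul_assoc, ← Finset.mul_sum]
  ring

/-- The mean square error is minimal for the update of `𝐮`. -/
lemma disturbance_div_received_le (c : ℂ) : N.disturbance p l / N.received p l ≤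
    1 - 2 * (star c * (N.chan l l * p l)).re + ‖c‖ ^ 2 * N.received p l := by
  have hJ := N.received_pos p l
  have hs : N.signal p l = ‖N.chan l l * p l‖ ^ 2 := by rw [norm_mul, mul_pow]; rfl
  have hD : N.disturbance p l = N.received p l - ‖N.chan l l * p l‖ ^ 2 := by
    rw [received_eq, hs]; ring
  rw [hD, div_le_iff₀ hJ, Complex.sq_norm, Complex.sq_norm, Complex.normSq_apply,
    Complex.normSq_apply]
  generalize N.chan l l * p l = g
  generalize N.received p l = J
  simp only [RCLike.star_def, Complex.mul_re, Complex.conj_re, Complex.conj_im]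
  -- With `g` the received amplitude, the gap between the two sides is `J * ‖c - g / J‖ ^ 2`.
  nlinarith [sq_nonneg (J * c.re - g.re), sq_nonneg (J * c.im - g.im)]

/-- After minimizing the error over `u`, this is `log t ≤ t - 1` at `t = w l * disturbance /
received`. -/
lemma rateMSE_le_rate (u : N.WirelessLink → ℂ) {w : N.WirelessLink → ℝ} (hw : 0 < w l) :
    N.rateMSE u w p l ≤ N.rate p l := by
  have hJ := N.received_pos p l
  have hD := N.disturbance_pos p l
  have he := N.disturbance_div_received_le p l (u l)
  have hpos : 0 < N.disturbance p l / N.received p l := div_pos hD hJ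
  rw [rateMSE_eq, rate_eq, ← inv_div, Real.log_inv]
  have h1 := Real.log_le_sub_one_of_pos (mul_pos hw hpos)
  rw [Real.log_mul hw.ne' hpos.ne'] at h1
  have h2 := mul_le_mul_of_nonneg_left he hw.le
  linarith

lemma updateU_eq : N.updateU p l = ((N.received p l)⁻¹ : ℝ) * (N.chan l l * p l) := by
  rw [Complex.ofReal_inv]
  rfl

lemma star_mul_updateU :
    star (N.chan l l * p l) * N.updateU p l = (N.signal p l / N.received p l : ℝ) := by
  have hs : N.signal p l = ‖N.chan l l * p l‖ ^ 2 := by rw [norm_mul, mul_pow]; rfl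
  rw [updateU_eq, mul_left_comm, hs]
  generalize N.chan l l * p l = g
  rw [RCLike.star_def, Complex.conj_mul', div_eq_inv_mul]
  push_cast
  ring

lemma updateW_updateU :
    N.updateW p (N.updateU p) l = N.received p l / N.disturbance p l := by
  have hJ := N.received_pos p l
  unfold updateW
  rw [star_mul_updateU, ← Complex.ofReal_one, ← Complex.ofReal_sub, ← Complex.ofReal_inv,
    Complex.ofReal_re, one_sub_div hJ.ne', inv_div]
  congr 1
  rw [received_eq]
  ring

lemma updateW_updateU_pos : 0 < N.updateW p (N.updateU p) l := by
  rw [updateW_updateU]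
  exact div_pos (N.received_pos p l) (N.disturbance_pos p l)

lemma norm_updateU_sq : ‖N.updateU p l‖ ^ 2 = N.signal p l / N.received p l ^ 2 := by
  have hJ := N.received_pos p l
  rw [updateU_eq, norm_mul, norm_mul, Complex.norm_real, Real.norm_of_nonneg (by positivity),
    signal]
  field_simp

lemma rateMSE_update :
    N.rateMSE (N.updateU p) (N.updateW p (N.updateU p)) p l = N.rate p l := by
  have hJ := N.received_pos p l
  have hD := N.disturbance_pos p l
  have h : (star (N.updateU p l) * (N.chan l l * p l)).re = N.signal p l / N.received p l := by
    have := congrArg (fun z => (star z).re) (N.star_mul_updateU p l)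
    simp only [star_mul, star_star] at this
    exact this.trans (by simp)
  rw [rateMSE_eq, rate_eq, updateW_updateU, h, norm_updateU_sq]
  have : N.received p l - N.signal p l = N.disturbance p l := by rw [received_eq]; ring
  field_simp
  rw [← this]
  ring

/-- A link without signal gets `u = 0` and `w = 1`, which freezes its minorant at zero whatever
precoders are chosen next. This is the degenerate case that rules out a Slater point. -/
lemma rateMSE_update_eq_zero (h : N.chan l l * p l = 0) :
    N.rateMSE (N.updateU p) (N.updateW p (N.updateU p)) q l = 0 := by
  have h1 : N.updateU p l = 0 := by rw [updateU_eq, h, mul_zero]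
  have h2 : N.updateW p (N.updateU p) l = 1 := by simp [updateW, h]
  rw [rateMSE_eq, h1, h2]
  simp

end Pointwise

/-! ### Comparison of the feasible sets -/

section Feasible

variable (N : HetNet R B U K M)

lemma subFeasible_subset_mainFeasible (u : N.WirelessLink → ℂ) {w : N.WirelessLink → ℝ}
    (hw : ∀ l, 0 < w l) : N.subFeasible u w ⊆ N.mainFeasible := fun _ hx =>
  ⟨hx.1, fun l => (hx.2 l).trans (N.rateMSE_le_rate _ l u (hw l))⟩

lemma mem_subFeasible_update {x : N.Var} (hx : x ∈ N.mainFeasible) :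
    x ∈ N.subFeasible (N.updateU (precoder x))
      (N.updateW (precoder x) (N.updateU (precoder x))) :=
  ⟨hx.1, fun l => (hx.2 l).trans (N.rateMSE_update _ l).ge⟩

lemma zero_mem_mainFeasible : (0 : N.Var) ∈ N.mainFeasible := by
  refine ⟨⟨le_rfl, fun _ => le_rfl, fun _ _ => le_rfl, fun l => ?_, fun s => ?_, fun v m => ?_⟩,
    fun l => ?_⟩
  · simpa [load, flow] using N.cap_nonneg l.1 l.2
  · simpa [usedPower, precoder] using N.power_nonneg s
  · simp [inflow, outflow, flow, commRate]
  · simpa [load, flow] using N.rate_nonneg (precoder (0 : N.Var)) l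

end Feasible

/-! ### Continuity of constraints and updates -/

section Continuity

variable (N : HetNet R B U K M)

lemma continuous_minRate : Continuous (minRate : N.Var → ℝ) := continuous_fst

lemma continuous_commRate (m : Fin M) : Continuous fun x : N.Var => commRate x m := by
  unfold commRate; fun_prop

lemma continuous_flow (l : N.Link) (m : Fin M) : Continuous fun x : N.Var => flow x l m := by
  unfold flow; fun_prop

lemma continuous_precoder : Continuous (precoder : N.Var → N.WirelessLink → ℂ) := by
  unfold precoder; fun_prop

lemma continuous_load (l : N.Link) : Continuous fun x : N.Var => load x l :=
  continuous_finsetSum _ fun m _ => N.continuous_flow l m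

lemma continuous_usedPower (s : B) : Continuous fun p => N.usedPower p s := by
  unfold usedPower; fun_prop

lemma continuous_received (l : N.WirelessLink) : Continuous fun p => N.received p l := by
  unfold received; fun_prop

lemma continuous_disturbance (l : N.WirelessLink) : Continuous fun p => N.disturbance p l := by
  unfold disturbance; fun_prop

lemma continuous_rate (l : N.WirelessLink) : Continuous fun p => N.rate p l := by
  simp only [rate_eq]
  exact ((N.continuous_received l).div (N.continuous_disturbance l)
    fun p => (N.disturbance_pos p l).ne').log
    fun p => (div_pos (N.received_pos p l) (N.disturbance_pos p l)).ne'

lemma continuous_updateU (l : N.WirelessLink) : Continuous fun p => N.updateU p l := by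
  simp only [updateU_eq]
  have := (N.continuous_received l).inv₀ fun p => (N.received_pos p l).ne'
  exact (Complex.continuous_ofReal.comp this).mul (by fun_prop)

lemma continuous_updateW (l : N.WirelessLink) :
    Continuous fun p => N.updateW p (N.updateU p) l := by
  simp only [updateW_updateU]
  exact (N.continuous_received l).div (N.continuous_disturbance l)
    fun p => (N.disturbance_pos p l).ne'

/-- The right-hand side of the rate-MSE constraint is continuous jointly in the precoders that
determine `𝐮` and `𝐰` and in the free precoders. -/
lemma continuous_rateMSE_update (l : N.WirelessLink) :
    Continuous fun z : (N.WirelessLink → ℂ) × (N.WirelessLink → ℂ) =>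
      N.rateMSE (N.updateU z.1) (N.updateW z.1 (N.updateU z.1)) z.2 l := by
  simp only [rateMSE_eq]
  have hu := (N.continuous_updateU l).comp
    (continuous_fst (X := N.WirelessLink → ℂ) (Y := N.WirelessLink → ℂ))
  have hw := (N.continuous_updateW l).comp
    (continuous_fst (X := N.WirelessLink → ℂ) (Y := N.WirelessLink → ℂ))
  have hr := (N.continuous_received l).comp
    (continuous_snd (X := N.WirelessLink → ℂ) (Y := N.WirelessLink → ℂ))
  have hl := hw.log fun z => (N.updateW_updateU_pos z.1 l).ne'
  simp only [Function.comp_def] at hu hw hr hl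
  have hs : Continuous fun z : (N.WirelessLink → ℂ) × (N.WirelessLink → ℂ) =>
      (star (N.updateU z.1 l) * (N.chan l l * z.2 l)).re :=
    Complex.continuous_re.comp (hu.star.mul (by fun_prop))
  fun_prop

end Continuity

/-! ### Compactness of the feasible set -/

section Compactness

variable (N : HetNet R B U K M)

lemma isClosed_mainFeasible : IsClosed N.mainFeasible := by
  have : N.mainFeasible = {x | 0 ≤ minRate x} ∩ (⋂ m, {x | minRate x ≤ commRate x m}) ∩
      (⋂ l, ⋂ m, {x | 0 ≤ flow x l m}) ∩
      (⋂ l : N.WiredLink, {x | load x (Sum.inl l) ≤ N.cap l.1}) ∩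
      (⋂ s, {x | N.usedPower (precoder x) s ≤ N.power s}) ∩
      (⋂ v, ⋂ m, {x | N.inflow x v m = N.outflow x v m}) ∩
      (⋂ l : N.WirelessLink, {x | load x (Sum.inr l) ≤ N.rate (precoder x) l}) := by
    ext x
    simp only [Set.mem_inter_iff, Set.mem_iInter, Set.mem_ofPred_eq]
    constructor
    · rintro ⟨⟨h1, h2, h3, h4, h5, h6⟩, h7⟩
      exact ⟨⟨⟨⟨⟨⟨h1, h2⟩, h3⟩, h4⟩, h5⟩, h6⟩, h7⟩
    · rintro ⟨⟨⟨⟨⟨⟨h1, h2⟩, h3⟩, h4⟩, h5⟩, h6⟩, h7⟩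
      exact ⟨⟨h1, h2, h3, h4, h5, h6⟩, h7⟩
  rw [this]
  have hc := N.continuous_commRate
  have hf := N.continuous_flow
  refine (((((((isClosed_le continuous_const N.continuous_minRate).inter
    (isClosed_iInter fun m => isClosed_le N.continuous_minRate (hc m))).inter
    (isClosed_iInter fun l => isClosed_iInter fun m => isClosed_le continuous_const (hf l m))).inter
    (isClosed_iInter fun l => isClosed_le (N.continuous_load _) continuous_const)).inter
    (isClosed_iInter fun s => isClosed_le
      ((N.continuous_usedPower s).comp N.continuous_precoder) continuous_const)).inter
    (isClosed_iInter fun v => isClosed_iInter fun m => isClosed_eq ?_ ?_)).inter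
    (isClosed_iInter fun l => isClosed_le (N.continuous_load _)
      ((N.continuous_rate l).comp N.continuous_precoder)))
  · unfold inflow
    refine (continuous_finsetSum _ fun l _ => hf l m).add ?_
    split_ifs
    exacts [hc m, continuous_const]
  · unfold outflow
    refine (continuous_finsetSum _ fun l _ => hf l m).add ?_
    split_ifs
    exacts [hc m, continuous_const]

lemma norm_sq_le_usedPower (p : N.WirelessLink → ℂ) (l : N.WirelessLink) :
    ‖p l‖ ^ 2 ≤ N.usedPower p (bs l) := by
  classical
  unfold usedPower
  exact Finset.single_le_sum (f := fun l => ‖p l‖ ^ 2) (fun _ _ => by positivity) (by simp)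

lemma rate_le (p : N.WirelessLink → ℂ) (l : N.WirelessLink) :
    N.rate p l ≤ ‖N.chan l l‖ ^ 2 * ‖p l‖ ^ 2 / N.noise (user l) := by
  have hD := N.disturbance_pos p l
  rw [rate_eq]
  refine (Real.log_le_sub_one_of_pos (div_pos (N.received_pos p l) hD)).trans ?_
  rw [received_eq, add_div, div_self hD.ne', add_sub_cancel_right]
  exact div_le_div_of_nonneg_left (N.signal_nonneg p l) (N.noise_pos _)
    (N.noise_le_disturbance p l)

/-- An upper bound of the load of a link. -/
noncomputable def loadBound (N : HetNet R B U K M) : N.Link → ℝ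
  | Sum.inl l => N.cap l.1
  | Sum.inr l => ‖N.chan l l‖ ^ 2 * N.power (bs l) / N.noise (user l)

lemma flow_le_loadBound {x : N.Var} (hx : x ∈ N.mainFeasible) (l : N.Link) (m : Fin M) :
    flow x l m ≤ N.loadBound l := by
  have h1 : flow x l m ≤ load x l :=
    Finset.single_le_sum (f := fun m => flow x l m) (fun m _ => hx.1.flow_nonneg l m)
      (Finset.mem_univ m)
  refine h1.trans ?_
  rcases l with l | l
  · exact hx.1.wired_cap l
  · refine (hx.2 l).trans ((N.rate_le _ l).trans ?_)
    have := (N.norm_sq_le_usedPower (precoder x) l).trans (hx.1.power_le _)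
    have := N.noise_pos (user l)
    show _ ≤ ‖N.chan l l‖ ^ 2 * N.power (bs l) / N.noise (user l)
    gcongr

/-- Flow conservation at the source: since it is not the destination, the injected rate leaves along
its outgoing links, whose flows are bounded. -/
lemma commRate_le {x : N.Var} (hx : x ∈ N.mainFeasible) (m : Fin M) :
    commRate x m ≤ ∑ l, N.loadBound l := by
  classical
  have h := hx.1.conservation (N.S m) m
  unfold inflow outflow at h
  rw [if_pos rfl, if_neg (N.S_ne_D m)] at h
  have h1 : 0 ≤ ∑ l : N.Link with N.dst l = N.S m, flow x l m :=
    Finset.sum_nonneg fun l _ => hx.1.flow_nonneg l m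
  have h2 : ∑ l : N.Link with N.src l = N.S m, flow x l m ≤ ∑ l, N.loadBound l :=
    (Finset.sum_le_sum_of_subset_of_nonneg (Finset.filter_subset _ _)
      fun l _ _ => hx.1.flow_nonneg l m).trans
      (Finset.sum_le_sum fun l _ => N.flow_le_loadBound hx l m)
  linarith

lemma isCompact_mainFeasible (hM : 1 ≤ M) : IsCompact N.mainFeasible := by
  have hK : IsCompact ((Set.Icc 0 (∑ l, N.loadBound l)) ×ˢ
      ((Set.univ.pi fun _ : Fin M => Set.Icc 0 (∑ l, N.loadBound l)) ×ˢ
      ((Set.univ.pi fun l : N.Link => Set.univ.pi fun _ : Fin M => Set.Icc 0 (N.loadBound l)) ×ˢ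
      (Set.univ.pi fun l : N.WirelessLink =>
        Metric.closedBall (0 : ℂ) (Real.sqrt (N.power (bs l)))))) : Set N.Var) :=
    isCompact_Icc.prod ((isCompact_univ_pi fun _ => isCompact_Icc).prod
      ((isCompact_univ_pi fun _ => isCompact_univ_pi fun _ => isCompact_Icc).prod
        (isCompact_univ_pi fun _ => isCompact_closedBall _ _)))
  refine hK.of_isClosed_subset N.isClosed_mainFeasible fun x hx => ?_
  have h0 := hx.1.minRate_nonneg
  simp only [Set.mem_prod, Set.mem_univ_pi, Set.mem_Icc, mem_closedBall_zero_iff]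
  -- The minimum rate is bounded only through some commodity rate, hence the need for `1 ≤ M`.
  refine ⟨⟨h0, (hx.1.minRate_le ⟨0, hM⟩).trans (N.commRate_le hx _)⟩,
    fun m => ⟨h0.trans (hx.1.minRate_le m), N.commRate_le hx m⟩,
    fun l m => ⟨hx.1.flow_nonneg l m, N.flow_le_loadBound hx l m⟩, fun l => ?_⟩
  exact Real.le_sqrt_of_sq_le ((N.norm_sq_le_usedPower (precoder x) l).trans (hx.1.power_le _))

end Compactness

/-! ### Correspondence of the global optima -/

section Optima

variable (N : HetNet R B U K M)

lemma update_mem_mseFeasible {x : N.Var} (hx : x ∈ N.mainFeasible) :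
    ((x, N.updateU (precoder x), N.updateW (precoder x) (N.updateU (precoder x))) : N.VarMSE) ∈
      N.mseFeasible :=
  ⟨N.updateW_updateU_pos _, N.mem_subFeasible_update hx⟩

lemma mem_mainFeasible_of_mem_mseFeasible {z : N.VarMSE} (hz : z ∈ N.mseFeasible) :
    z.1 ∈ N.mainFeasible :=
  N.subFeasible_subset_mainFeasible _ hz.1 hz.2

variable {N}

lemma IsMainOptimal.isMSEOptimal {x : N.Var} (hx : N.IsMainOptimal x) :
    N.IsMSEOptimal (x, N.updateU (precoder x),
      N.updateW (precoder x) (N.updateU (precoder x))) :=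
  ⟨N.update_mem_mseFeasible hx.1, fun _ hz => hx.2 (N.mem_mainFeasible_of_mem_mseFeasible hz)⟩

lemma IsMSEOptimal.isMainOptimal {z : N.VarMSE} (hz : N.IsMSEOptimal z) :
    N.IsMainOptimal z.1 :=
  ⟨N.mem_mainFeasible_of_mem_mseFeasible hz.1, fun _ hx => hz.2 (N.update_mem_mseFeasible hx)⟩

variable (N)

lemma exists_isMainOptimal (hM : 1 ≤ M) : ∃ x, N.IsMainOptimal x :=
  (N.isCompact_mainFeasible hM).exists_isMaxOn ⟨0, N.zero_mem_mainFeasible⟩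
    N.continuous_minRate.continuousOn

lemma exists_isGreatest (hM : 1 ≤ M) : ∃ v : ℝ, IsGreatest (minRate '' N.mainFeasible) v ∧
    IsGreatest (mseObjective '' N.mseFeasible) v := by
  obtain ⟨x, hx⟩ := N.exists_isMainOptimal hM
  refine ⟨minRate x, ⟨⟨x, hx.1, rfl⟩, ?_⟩, ⟨⟨_, hx.isMSEOptimal.1, rfl⟩, ?_⟩⟩
  · rintro _ ⟨y, hy, rfl⟩
    exact hx.2 hy
  · rintro _ ⟨z, hz, rfl⟩
    exact hx.isMSEOptimal.2 hz

end Optima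

end HetNet

/-! ### Constraints along a short ray -/

-- For the curved constraints: an active one needs a strictly positive derivative to survive a short
-- move.
open Filter Topology in
lemma eventually_pos_of_hasDerivAt {φ : ℝ → ℝ} {a : ℝ} (h : HasDerivAt φ a 0) (h0 : 0 ≤ φ 0)
    (ha : φ 0 = 0 → 0 < a) : ∀ᶠ t in 𝓝[>] 0, 0 < φ t := by
  rcases h0.lt_or_eq with h0 | h0
  · exact (h.continuousAt.eventually (lt_mem_nhds h0)).filter_mono nhdsWithin_le_nhds
  · have h1 := hasDerivAt_iff_tendsto_slope.1 h
    have h2 := (h1.mono_left (nhdsWithin_mono _ fun t (ht : 0 < t) => ht.ne')).eventually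
      (lt_mem_nhds (ha h0.symm))
    filter_upwards [h2, self_mem_nhdsWithin] with t ht (ht0 : 0 < t)
    rw [slope_def_field, ← h0, sub_zero, sub_zero] at ht
    exact (div_pos_iff_of_pos_right ht0).1 ht

-- For the affine constraints: here a nonnegative slope is enough, so they need no strictness.
open Filter Topology in
lemma eventually_add_mul_nonneg {a b : ℝ} (ha : 0 ≤ a) (hb : a = 0 → 0 ≤ b) :
    ∀ᶠ t in 𝓝[>] 0, 0 ≤ a + t * b := by
  rcases ha.lt_or_eq with ha | ha
  · have : ContinuousAt (fun t : ℝ => a + t * b) 0 := by fun_prop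
    have h := this.eventually (lt_mem_nhds (a := 0) (by simpa using ha))
    exact (h.filter_mono nhdsWithin_le_nhds).mono fun t ht => ht.le
  · filter_upwards [self_mem_nhdsWithin] with t (ht : 0 < t)
    rw [← ha, zero_add]
    exact mul_nonneg ht.le (hb ha.symm)

namespace HetNet

variable {R B U : Type*} {K M : ℕ}

/-! ### Derivatives of the constraints -/

section Gradients

variable (N : HetNet R B U K M)

/-- `minRate` as a continuous linear functional. -/
noncomputable def minRateL : N.Var →L[ℝ] ℝ := ContinuousLinearMap.fst ℝ _ _

/-- `commRate` as a family of continuous linear functionals. -/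
noncomputable def commRateL (m : Fin M) : N.Var →L[ℝ] ℝ :=
  ContinuousLinearMap.proj m ∘L ContinuousLinearMap.fst ℝ _ _ ∘L ContinuousLinearMap.snd ℝ _ _

/-- `flow` as a family of continuous linear functionals. -/
noncomputable def flowL (l : N.Link) (m : Fin M) : N.Var →L[ℝ] ℝ :=
  ContinuousLinearMap.proj m ∘L ContinuousLinearMap.proj l ∘L ContinuousLinearMap.fst ℝ _ _ ∘L
    ContinuousLinearMap.snd ℝ _ _ ∘L ContinuousLinearMap.snd ℝ _ _

/-- `precoder` as a family of continuous linear maps. -/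
noncomputable def precoderL (l : N.WirelessLink) : N.Var →L[ℝ] ℂ :=
  ContinuousLinearMap.proj l ∘L ContinuousLinearMap.snd ℝ _ _ ∘L
    ContinuousLinearMap.snd ℝ _ _ ∘L ContinuousLinearMap.snd ℝ _ _

/-- `load` as a family of continuous linear functionals. -/
noncomputable def loadL (l : N.Link) : N.Var →L[ℝ] ℝ := ∑ m, N.flowL l m

open Classical in
/-- The excess of `inflow` over `outflow` as a family of continuous linear functionals. -/
noncomputable def excessL (v : Node R B U) (m : Fin M) : N.Var →L[ℝ] ℝ :=
  (∑ l : N.Link with N.dst l = v, N.flowL l m) + (if v = N.S m then N.commRateL m else 0) -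
    ((∑ l : N.Link with N.src l = v, N.flowL l m) + (if v = N.D m then N.commRateL m else 0))

/-- The derivative at `y` of the squared modulus of a precoder. -/
noncomputable def normSqL (y : N.Var) (l : N.WirelessLink) : N.Var →L[ℝ] ℝ :=
  2 • (innerSL ℝ (precoder y l)) ∘L N.precoderL l

open Classical in
/-- The derivative at `y` of the used power. -/
noncomputable def powerL (y : N.Var) (s : B) : N.Var →L[ℝ] ℝ :=
  ∑ l : N.WirelessLink with bs l = s, N.normSqL y l

/-- The derivative at `y` of the right-hand side of the rate-MSE constraint. -/
noncomputable def rateMSEL (u : N.WirelessLink → ℂ) (w : N.WirelessLink → ℝ) (y : N.Var)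
    (l : N.WirelessLink) : N.Var →L[ℝ] ℝ :=
  (2 * w l) • (Complex.reCLM ∘L
      (ContinuousLinearMap.mul ℝ ℂ (star (u l) * N.chan l l)) ∘L N.precoderL l) -
    ∑ n ∈ N.interferers l, (w l * ‖u l‖ ^ 2 * ‖N.chan l n‖ ^ 2) • N.normSqL y n

@[simp] lemma minRateL_apply (x : N.Var) : N.minRateL x = minRate x := rfl
@[simp] lemma commRateL_apply (m : Fin M) (x : N.Var) : N.commRateL m x = commRate x m := rfl
@[simp] lemma flowL_apply (l : N.Link) (m : Fin M) (x : N.Var) :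
    N.flowL l m x = flow x l m := rfl
@[simp] lemma precoderL_apply (l : N.WirelessLink) (x : N.Var) :
    N.precoderL l x = precoder x l := rfl
@[simp] lemma loadL_apply (l : N.Link) (x : N.Var) : N.loadL l x = load x l := by
  simp [loadL, load]
@[simp] lemma excessL_apply (v : Node R B U) (m : Fin M) (x : N.Var) :
    N.excessL v m x = N.inflow x v m - N.outflow x v m := by
  unfold excessL inflow outflow
  simp only [sub_apply, add_apply, _root_.sum_apply, flowL_apply]
  congr 2 <;> split_ifs <;> simp

lemma normSqL_apply (y x : N.Var) (l : N.WirelessLink) :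
    N.normSqL y l x = 2 * inner ℝ (precoder y l) (precoder x l) := by
  simp only [normSqL, smul_apply, ContinuousLinearMap.comp_apply, precoderL_apply,
    innerSL_apply_apply, nsmul_eq_mul, Nat.cast_ofNat]

lemma normSqL_self (y : N.Var) (l : N.WirelessLink) : N.normSqL y l y = 2 * ‖precoder y l‖ ^ 2 := by
  rw [normSqL_apply, real_inner_self_eq_norm_sq]

lemma powerL_self (y : N.Var) (s : B) : N.powerL y s y = 2 * N.usedPower (precoder y) s := by
  unfold powerL usedPower
  simp only [_root_.sum_apply, normSqL_self, Finset.mul_sum]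

/-- The derivatives at `y` do not see the precoders that vanish at `y`. -/
lemma normSqL_congr {y d d' : N.Var} (l : N.WirelessLink)
    (h : precoder y l ≠ 0 → precoder d l = precoder d' l) :
    N.normSqL y l d = N.normSqL y l d' := by
  rw [normSqL_apply, normSqL_apply]
  by_cases h0 : precoder y l = 0
  · simp [h0]
  · rw [h h0]

lemma powerL_congr {y d d' : N.Var} (s : B)
    (h : ∀ l, precoder y l ≠ 0 → precoder d l = precoder d' l) :
    N.powerL y s d = N.powerL y s d' := by
  unfold powerL
  simp only [_root_.sum_apply]
  exact Finset.sum_congr rfl fun l _ => N.normSqL_congr l (h l)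

/-- The quadratic terms have derivative zero at a vanishing precoder, and the linear term has the
factor `star (u l)`, which vanishes together with `precoder y l`. -/
lemma rateMSEL_congr {y d d' : N.Var} (w : N.WirelessLink → ℝ) (l : N.WirelessLink)
    (h : ∀ l, precoder y l ≠ 0 → precoder d l = precoder d' l) :
    N.rateMSEL (N.updateU (precoder y)) w y l d = N.rateMSEL (N.updateU (precoder y)) w y l d' := by
  unfold rateMSEL
  have h1 : ∀ n, N.normSqL y n d = N.normSqL y n d' := fun n => N.normSqL_congr n (h n)
  simp only [sub_apply, _root_.sum_apply, smul_apply, h1, ContinuousLinearMap.comp_apply,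
    precoderL_apply, ContinuousLinearMap.mul_apply']
  by_cases h0 : precoder y l = 0
  · simp [updateU_eq, h0]
  · rw [h l h0]

lemma hasFDerivAt_norm_sq (y : N.Var) (l : N.WirelessLink) :
    HasFDerivAt (fun x : N.Var => ‖precoder x l‖ ^ 2) (N.normSqL y l) y :=
  (N.precoderL l).hasFDerivAt (x := y) |>.norm_sq

lemma hasFDerivAt_usedPower (y : N.Var) (s : B) :
    HasFDerivAt (fun x : N.Var => N.usedPower (precoder x) s) (N.powerL y s) y :=
  HasFDerivAt.fun_sum fun l _ => N.hasFDerivAt_norm_sq y l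

lemma hasFDerivAt_rateMSE (u : N.WirelessLink → ℂ) (w : N.WirelessLink → ℝ) (y : N.Var)
    (l : N.WirelessLink) :
    HasFDerivAt (fun x : N.Var => N.rateMSE u w (precoder x) l) (N.rateMSEL u w y l) y := by
  unfold rateMSE rateMSEL
  refine HasFDerivAt.sub ?_ (HasFDerivAt.fun_sum fun n _ =>
    (N.hasFDerivAt_norm_sq y n).const_mul _)
  exact HasFDerivAt.const_add _ (((Complex.reCLM ∘L
      (ContinuousLinearMap.mul ℝ ℂ (star (u l) * N.chan l l)) ∘L N.precoderL l).hasFDerivAt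
      ).const_mul (2 * w l))

lemma differentiableAt_rate (y : N.Var) (l : N.WirelessLink) :
    DifferentiableAt ℝ (fun x : N.Var => N.rate (precoder x) l) y := by
  have hn : ∀ n, DifferentiableAt ℝ (fun x : N.Var => ‖precoder x n‖ ^ 2) y :=
    fun n => (N.hasFDerivAt_norm_sq y n).differentiableAt
  have h1 : DifferentiableAt ℝ (fun x : N.Var => N.received (precoder x) l) y :=
    (DifferentiableAt.fun_sum fun n _ => (hn n).const_mul _).add_const _
  have h2 : DifferentiableAt ℝ (fun x : N.Var => N.disturbance (precoder x) l) y :=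
    (DifferentiableAt.fun_sum fun n _ => (hn n).const_mul _).add_const _
  have hJ := fun x : N.Var => (N.received_pos (precoder x) l).ne'
  have hD := fun x : N.Var => (N.disturbance_pos (precoder x) l).ne'
  simp only [rate_eq, Real.log_div (hJ _) (hD _)]
  exact (h1.log (hJ y)).fun_sub (h2.log (hD y))

/-- The rate is tangent to the right-hand side of the rate-MSE constraint for the updated
`𝐮` and `𝐰`. -/
lemma hasFDerivAt_rate (y : N.Var) (l : N.WirelessLink) :
    HasFDerivAt (fun x : N.Var => N.rate (precoder x) l)
      (N.rateMSEL (N.updateU (precoder y)) (N.updateW (precoder y) (N.updateU (precoder y))) y l)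
      y := by
  have h1 := (N.differentiableAt_rate y l).hasFDerivAt
  have h2 := N.hasFDerivAt_rateMSE (N.updateU (precoder y))
    (N.updateW (precoder y) (N.updateU (precoder y))) y l
  -- The rate minus its minorant is nonnegative and zero at `y`, so its derivative vanishes there;
  -- the derivative of the rate need not be computed.
  have hmin : IsLocalMin (fun x : N.Var => N.rate (precoder x) l -
      N.rateMSE (N.updateU (precoder y)) (N.updateW (precoder y) (N.updateU (precoder y)))
        (precoder x) l) y := by
    refine Filter.Eventually.of_forall fun x => ?_
    simp only [rateMSE_update, sub_self, sub_nonneg]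
    exact N.rateMSE_le_rate _ _ _ (N.updateW_updateU_pos _ l)
  have h3 := hmin.hasFDerivAt_eq_zero (h1.sub h2)
  rwa [sub_eq_zero.1 h3] at h1

end Gradients

/-! ### From multipliers to the KKT conditions -/

section Constraints

variable (N : HetNet R B U K M)

/-- The index type of the inequality constraints of the main problem. -/
abbrev IneqIndex (N : HetNet R B U K M) :=
  Unit ⊕ Fin M ⊕ (N.Link × Fin M) ⊕ N.Link ⊕ B

/-- The inequality constraints of the main problem, in the form `0 ≤ N.ineq i x`. -/
noncomputable def ineq (x : N.Var) : N.IneqIndex → ℝ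
  | Sum.inl _ => minRate x
  | Sum.inr (Sum.inl m) => commRate x m - minRate x
  | Sum.inr (Sum.inr (Sum.inl q)) => flow x q.1 q.2
  | Sum.inr (Sum.inr (Sum.inr (Sum.inl l))) => N.linkCap (precoder x) l - load x l
  | Sum.inr (Sum.inr (Sum.inr (Sum.inr s))) => N.power s - N.usedPower (precoder x) s

/-- The derivative at `y` of the capacity of a link. -/
noncomputable def linkCapL (y : N.Var) : N.Link → N.Var →L[ℝ] ℝ
  | Sum.inl _ => 0
  | Sum.inr l => N.rateMSEL (N.updateU (precoder y))
      (N.updateW (precoder y) (N.updateU (precoder y))) y l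

/-- The derivatives at `y` of the inequality constraints of the main problem. -/
noncomputable def ineqL (y : N.Var) : N.IneqIndex → N.Var →L[ℝ] ℝ
  | Sum.inl _ => N.minRateL
  | Sum.inr (Sum.inl m) => N.commRateL m - N.minRateL
  | Sum.inr (Sum.inr (Sum.inl q)) => N.flowL q.1 q.2
  | Sum.inr (Sum.inr (Sum.inr (Sum.inl l))) => N.linkCapL y l - N.loadL l
  | Sum.inr (Sum.inr (Sum.inr (Sum.inr s))) => -N.powerL y s

lemma hasFDerivAt_linkCap (y : N.Var) (l : N.Link) :
    HasFDerivAt (fun x : N.Var => N.linkCap (precoder x) l) (N.linkCapL y l) y := by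
  rcases l with l | l
  · exact hasFDerivAt_const _ _
  · exact N.hasFDerivAt_rate y l

lemma hasFDerivAt_load (y : N.Var) (l : N.Link) :
    HasFDerivAt (fun x : N.Var => load x l) (N.loadL l) y := by
  have : (fun x : N.Var => load x l) = N.loadL l := funext fun x => (N.loadL_apply l x).symm
  rw [this]
  exact (N.loadL l).hasFDerivAt

lemma hasFDerivAt_ineq (y : N.Var) (i : N.IneqIndex) :
    HasFDerivAt (fun x => N.ineq x i) (N.ineqL y i) y := by
  rcases i with _ | m | q | l | s
  · exact N.minRateL.hasFDerivAt
  · exact (N.commRateL m - N.minRateL).hasFDerivAt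
  · exact (N.flowL q.1 q.2).hasFDerivAt
  · exact (N.hasFDerivAt_linkCap y l).sub (N.hasFDerivAt_load y l)
  · exact (N.hasFDerivAt_usedPower y s).const_sub _

variable [Fintype R] [Fintype B] [Fintype U]

open Classical in
/-- Multipliers for the linearized problem make a feasible point stationary. -/
lemma isKKT_of_multipliers {y : N.Var} (hy : y ∈ N.mainFeasible) (c : N.IneqIndex → ℝ)
    (e : Node R B U × Fin M → ℝ) (hc : ∀ i, 0 ≤ c i)
    (h : N.minRateL + ∑ i with N.ineq y i = 0, c i • N.ineqL y i +
      ∑ j, e j • N.excessL j.1 j.2 = 0) : N.IsKKT y := by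
  -- Setting the multipliers of inactive constraints to zero gives complementary slackness.
  set c' : N.IneqIndex → ℝ := fun i => if N.ineq y i = 0 then c i else 0 with hc'
  have hc0 : ∀ i, 0 ≤ c' i := fun i => by
    simp only [hc']
    split_ifs
    exacts [hc i, le_rfl]
  have hcs : ∀ i, c' i * N.ineq y i = 0 := fun i => by
    simp only [hc']
    split_ifs with h
    · rw [h, mul_zero]
    · rw [zero_mul]
  have hsum : N.minRateL + ∑ i, c' i • N.ineqL y i + ∑ j, e j • N.excessL j.1 j.2 = 0 := by
    rw [← h, Finset.sum_filter]
    simp only [hc', ite_smul, zero_smul]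
  refine ⟨hy, ⟨c' (Sum.inl ()), fun m => c' (Sum.inr (Sum.inl m)),
    fun l m => c' (Sum.inr (Sum.inr (Sum.inl (l, m)))),
    fun l => c' (Sum.inr (Sum.inr (Sum.inr (Sum.inl l)))),
    fun s => c' (Sum.inr (Sum.inr (Sum.inr (Sum.inr s)))), fun v m => e (v, m)⟩,
    ⟨hc0 _, fun _ => hc0 _, fun _ _ => hc0 _, fun _ => hc0 _, fun _ => hc0 _⟩,
    ⟨hcs (Sum.inl ()), fun m => hcs (Sum.inr (Sum.inl m)),
      fun l m => hcs (Sum.inr (Sum.inr (Sum.inl (l, m)))),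
      fun l => hcs (Sum.inr (Sum.inr (Sum.inr (Sum.inl l)))),
      fun s => hcs (Sum.inr (Sum.inr (Sum.inr (Sum.inr s))))⟩, ?_⟩
  rw [← hsum]
  have hd := ((N.minRateL.hasFDerivAt (x := y)).add (HasFDerivAt.fun_sum (u := Finset.univ)
    fun i _ => (N.hasFDerivAt_ineq y i).const_mul (c' i))).add
    (HasFDerivAt.fun_sum (u := Finset.univ) fun j _ =>
      (N.excessL j.1 j.2).hasFDerivAt.const_mul (e j))
  refine hd.congr_of_eventuallyEq (Filter.Eventually.of_forall fun x => ?_)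
  simp only [lagrangian, Pi.add_apply, Fintype.sum_sum_type, Fintype.sum_prod_type, ineq,
    minRateL_apply, excessL_apply, Finset.univ_unique, Finset.sum_singleton,
    PUnit.default_eq_unit]
  ring

end Constraints

open Filter Topology

/-! ### Improving a point that is not stationary -/

section Direction

variable (N : HetNet R B U K M)

lemma minRate_add_smul (y v : N.Var) (t : ℝ) : minRate (y + t • v) = minRate y + t * minRate v :=
  rfl

lemma commRate_add_smul (y v : N.Var) (t : ℝ) (m : Fin M) :
    commRate (y + t • v) m = commRate y m + t * commRate v m := rfl

lemma flow_add_smul (y v : N.Var) (t : ℝ) (l : N.Link) (m : Fin M) :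
    flow (y + t • v) l m = flow y l m + t * flow v l m := rfl

lemma precoder_add_smul (y v : N.Var) (t : ℝ) (l : N.WirelessLink) :
    precoder (y + t • v) l = precoder y l + t • precoder v l := rfl

lemma load_add_smul (y v : N.Var) (t : ℝ) (l : N.Link) :
    load (y + t • v) l = load y l + t * load v l := by
  simp only [← loadL_apply, map_add, map_smul, smul_eq_mul]

lemma hasDerivAt_line {g : N.Var → ℝ} {g' : N.Var →L[ℝ] ℝ} {y : N.Var} (h : HasFDerivAt g g' y)
    (v : N.Var) : HasDerivAt (fun t : ℝ => g (y + t • v)) (g' v) 0 := by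
  have h1 : HasDerivAt (fun t : ℝ => y + t • v) v 0 := by
    simpa using ((hasDerivAt_id (0 : ℝ)).smul_const v).const_add y
  have h2 : HasFDerivAt g g' (y + (0 : ℝ) • v) := by simpa using h
  exact h2.comp_hasDerivAt 0 h1

/-- The direction `d`, with the precoders removed that vanish at `y`. -/
noncomputable def maskPrecoder (y d : N.Var) : N.Var :=
  open Classical in
  (minRate d, commRate d, flow d, fun l => if precoder y l = 0 then 0 else precoder d l)

/-- The direction that shrinks all rates and, at the speed `ε`, all precoders of `y`. -/
noncomputable def shrink (ε : ℝ) (y : N.Var) : N.Var :=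
  (-minRate y, -commRate y, -flow y, -(ε • precoder y))

lemma precoder_shrink (ε : ℝ) (y : N.Var) (l : N.WirelessLink) :
    precoder (N.shrink ε y) l = -(ε • precoder y l) := rfl

lemma precoder_maskPrecoder_of_eq_zero {y : N.Var} {l : N.WirelessLink} (h : precoder y l = 0)
    (d : N.Var) : precoder (N.maskPrecoder y d) l = 0 :=
  if_pos h

lemma precoder_maskPrecoder_of_ne_zero {y : N.Var} {l : N.WirelessLink} (h : precoder y l ≠ 0)
    (d : N.Var) : precoder (N.maskPrecoder y d) l = precoder d l :=
  if_neg h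

variable {N}

/-- A point that is better than `y`, and is strictly feasible for the non-affine constraints of the
problem that results from fixing the values of `𝐮` and `𝐰` that belong to `y`. -/
structure Improves (x y : N.Var) : Prop where
  base : N.BaseFeasible x
  lt : minRate y < minRate x
  power_lt : ∀ s, 0 < N.power s → N.usedPower (precoder x) s < N.power s
  precoder_eq_zero : ∀ l, precoder y l = 0 → precoder x l = 0
  load_le_zero : ∀ l, N.chan l l * precoder y l = 0 → load x (Sum.inr l) ≤ 0
  load_lt : ∀ l, N.chan l l * precoder y l ≠ 0 → load x (Sum.inr l) <
    N.rateMSE (N.updateU (precoder y)) (N.updateW (precoder y) (N.updateU (precoder y)))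
      (precoder x) l

lemma usedPower_eq_zero {p : N.WirelessLink → ℂ} {s : B} (h : ∀ l, bs l = s → p l = 0) :
    N.usedPower p s = 0 := by
  unfold usedPower
  refine Finset.sum_eq_zero fun l hl => ?_
  rw [h l (by simpa using hl)]
  simp

lemma precoder_eq_zero_of_power {y : N.Var} (hy : y ∈ N.mainFeasible) {l : N.WirelessLink}
    (h : N.power (bs l) = 0) : precoder y l = 0 := by
  have h1 := (N.norm_sq_le_usedPower (precoder y) l).trans (hy.1.power_le _)
  rw [h] at h1
  simpa using h1

lemma load_nonneg {y : N.Var} (hy : y ∈ N.mainFeasible) (l : N.Link) : 0 ≤ load y l :=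
  Finset.sum_nonneg fun m _ => hy.1.flow_nonneg l m

/-- Along a direction of increase of the linearized problem, slightly bent towards a Slater point,
there are improvements. -/
lemma exists_improves_of_direction [Finite B] {y d : N.Var} (hy : y ∈ N.mainFeasible)
    (hd : 0 < minRate d) (hineq : ∀ i, N.ineq y i = 0 → 0 ≤ N.ineqL y i d)
    (hcons : ∀ v m, N.excessL v m d = 0) : ∃ x : N.Var, Improves x y := by
  set u := N.updateU (precoder y) with hu
  set w := N.updateW (precoder y) u with hw
  -- Shrinking the rates frees capacity equal to the load, which is the rate on an active link.
  -- Precoders must shrink so slowly that the loss in the minorant stays below this; possible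
  -- because the rate is positive on links with signal.
  obtain ⟨ε, hε, hεl⟩ : ∃ ε : ℝ, 0 < ε ∧ ∀ l, N.chan l l * precoder y l ≠ 0 →
      0 < N.rate (precoder y) l - ε * N.rateMSEL u w y l y := by
    have : ∀ l : N.WirelessLink, ∀ᶠ ε in 𝓝[>] (0 : ℝ), N.chan l l * precoder y l ≠ 0 →
        0 < N.rate (precoder y) l - ε * N.rateMSEL u w y l y := fun l => by
      by_cases h : N.chan l l * precoder y l = 0
      · exact Eventually.of_forall fun _ hn => absurd h hn
      have hc : ContinuousAt
          (fun ε : ℝ => N.rate (precoder y) l - ε * N.rateMSEL u w y l y) 0 := by fun_prop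
      refine ((hc.eventually (lt_mem_nhds (a := 0) ?_)).filter_mono nhdsWithin_le_nhds).mono
        fun _ ht _ => ht
      simpa using N.rate_pos _ l h
    obtain ⟨ε, h1, h2⟩ := ((eventually_all.2 this).and self_mem_nhdsWithin).exists
    exact ⟨ε, h2, h1⟩
  obtain ⟨η, hη, hηd⟩ : ∃ η : ℝ, 0 < η ∧ 0 < minRate d - η * minRate y := by
    have hc : ContinuousAt (fun η : ℝ => minRate d - η * minRate y) 0 := by fun_prop
    have := (hc.eventually (lt_mem_nhds (a := 0) (by simpa using hd))).filter_mono
      (nhdsWithin_le_nhds (s := Set.Ioi 0))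
    obtain ⟨η, h1, h2⟩ := (this.and self_mem_nhdsWithin).exists
    exact ⟨η, h2, h1⟩
  -- Masking does not alter the derivatives at `y`, and it keeps the vanishing precoders of `y` at
  -- zero. The shrinking part supplies the strictness; `η` is small enough to keep the objective
  -- increasing.
  set v : N.Var := N.maskPrecoder y d + η • N.shrink ε y with hv
  have hvr : minRate v = minRate d - η * minRate y := by
    rw [hv, minRate_add_smul]
    simp only [maskPrecoder, shrink, minRate]
    ring
  have hvc : ∀ m, commRate v m = commRate d m - η * commRate y m := fun m => by
    rw [hv, commRate_add_smul]
    simp only [maskPrecoder, shrink, commRate, Pi.neg_apply]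
    ring
  have hvf : ∀ l m, flow v l m = flow d l m - η * flow y l m := fun l m => by
    rw [hv, flow_add_smul]
    simp only [maskPrecoder, shrink, flow, Pi.neg_apply]
    ring
  have hvl : ∀ l, load v l = load d l - η * load y l := fun l => by
    simp only [load, hvf, Finset.sum_sub_distrib, Finset.mul_sum]
  have hvp : ∀ l, precoder y l = 0 → precoder v l = 0 := fun l hl => by
    rw [hv, precoder_add_smul, N.precoder_maskPrecoder_of_eq_zero hl, precoder_shrink, hl,
      smul_zero, neg_zero, smul_zero, add_zero]
  have hvp' : ∀ l, precoder y l ≠ 0 → precoder v l = precoder (d - (η * ε) • y) l :=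
    fun l hl => by
    rw [hv, precoder_add_smul, N.precoder_maskPrecoder_of_ne_zero hl, precoder_shrink, smul_neg,
      smul_smul, ← sub_eq_add_neg]
    rfl
  have hvE : ∀ l, N.rateMSEL u w y l v =
      N.rateMSEL u w y l d - η * ε * N.rateMSEL u w y l y := fun l => by
    rw [N.rateMSEL_congr w l hvp', map_sub, map_smul, smul_eq_mul]
  have hvP : ∀ s, N.powerL y s v = N.powerL y s d - η * ε * (2 * N.usedPower (precoder y) s) :=
    fun s => by
    rw [N.powerL_congr s hvp', map_sub, map_smul, smul_eq_mul, powerL_self]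
  have e_comm : ∀ m, ∀ᶠ t in 𝓝[>] (0 : ℝ), 0 ≤ (commRate y m - minRate y) +
      t * (commRate v m - minRate v) := fun m => by
    refine eventually_add_mul_nonneg (sub_nonneg.2 (hy.1.minRate_le m)) fun h0 => ?_
    have := hineq (Sum.inr (Sum.inl m)) h0
    simp only [ineqL, sub_apply, commRateL_apply, minRateL_apply] at this
    rw [hvc, hvr]
    linear_combination this + η * h0
  have e_flow : ∀ l m, ∀ᶠ t in 𝓝[>] (0 : ℝ), 0 ≤ flow y l m + t * flow v l m := fun l m => by
    refine eventually_add_mul_nonneg (hy.1.flow_nonneg l m) fun h0 => ?_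
    have := hineq (Sum.inr (Sum.inr (Sum.inl (l, m)))) h0
    simp only [ineqL, flowL_apply] at this
    rw [hvf, h0]
    linarith
  have e_wired : ∀ l : N.WiredLink, ∀ᶠ t in 𝓝[>] (0 : ℝ),
      0 ≤ (N.cap l.1 - load y (Sum.inl l)) + t * -load v (Sum.inl l) := fun l => by
    refine eventually_add_mul_nonneg (sub_nonneg.2 (hy.1.wired_cap l)) fun h0 => ?_
    have := hineq (Sum.inr (Sum.inr (Sum.inr (Sum.inl (Sum.inl l))))) h0
    simp only [ineqL, linkCapL, sub_apply, zero_apply, loadL_apply] at this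
    rw [hvl]
    have := mul_nonneg hη.le (load_nonneg hy (Sum.inl l))
    linarith
  have e_power : ∀ s, ∀ᶠ t in 𝓝[>] (0 : ℝ), 0 < N.power s →
      0 < N.power s - N.usedPower (precoder (y + t • v)) s := fun s => by
    by_cases hs : 0 < N.power s
    swap
    · exact Eventually.of_forall fun _ h => absurd h hs
    refine (eventually_pos_of_hasDerivAt
      (N.hasDerivAt_line ((N.hasFDerivAt_usedPower y s).const_sub (N.power s)) v) ?_ ?_).mono
      fun _ h _ => h
    · simpa using hy.1.power_le s
    · intro h0
      simp only [zero_smul, add_zero] at h0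
      have := hineq (Sum.inr (Sum.inr (Sum.inr (Sum.inr s)))) h0
      simp only [ineqL, neg_apply] at this ⊢
      rw [hvP, ← sub_eq_zero.1 h0]
      -- On an active budget the shrinking frees power at the rate `2 * η * ε * N.power s`.
      have : 0 < η * ε * (2 * N.power s) := by positivity
      linarith
  have e_bad : ∀ l : N.WirelessLink, N.chan l l * precoder y l = 0 →
      ∀ t : ℝ, 0 < t → load (y + t • v) (Sum.inr l) ≤ 0 := fun l hl t ht => by
    have h0 : load y (Sum.inr l) = 0 :=
      le_antisymm ((hy.2 l).trans (N.rate_eq_zero _ l hl).le) (load_nonneg hy _)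
    -- The minorant of a link without signal is constant, so the linearized constraint alone
    -- prevents the load from growing.
    have h1 : N.rateMSEL u w y l d = 0 := by
      have h2 := N.hasFDerivAt_rateMSE u w y l
      have h3 : (fun x : N.Var => N.rateMSE u w (precoder x) l) = fun _ => 0 :=
        funext fun x => N.rateMSE_update_eq_zero (precoder y) (precoder x) l hl
      rw [h3] at h2
      rw [h2.unique (hasFDerivAt_const _ _), zero_apply]
    have := hineq (Sum.inr (Sum.inr (Sum.inr (Sum.inl (Sum.inr l)))))
      (by simp only [ineq, linkCap, h0, N.rate_eq_zero _ l hl, sub_zero])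
    simp only [ineqL, linkCapL, sub_apply, loadL_apply, ← hu, ← hw, h1] at this
    rw [load_add_smul, hvl, h0]
    have := mul_nonneg ht.le (by linarith : 0 ≤ -load d (Sum.inr l))
    linarith
  have e_good : ∀ l : N.WirelessLink, ∀ᶠ t in 𝓝[>] (0 : ℝ), N.chan l l * precoder y l ≠ 0 →
      0 < N.rateMSE u w (precoder (y + t • v)) l - load (y + t • v) (Sum.inr l) := fun l => by
    by_cases hl : N.chan l l * precoder y l = 0
    · exact Eventually.of_forall fun _ h => absurd hl h
    refine (eventually_pos_of_hasDerivAt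
      (N.hasDerivAt_line ((N.hasFDerivAt_rateMSE u w y l).sub
        (N.hasFDerivAt_load y (Sum.inr l))) v) ?_ ?_).mono fun _ h _ => h
    · simpa [hu, hw, rateMSE_update] using hy.2 l
    · intro h0
      simp only [zero_smul, add_zero, Pi.sub_apply, hu, hw, rateMSE_update] at h0
      have h1 := hineq (Sum.inr (Sum.inr (Sum.inr (Sum.inl (Sum.inr l))))) h0
      simp only [ineqL, linkCapL, sub_apply, loadL_apply, ← hu, ← hw] at h1 ⊢
      rw [hvE, hvl, ← sub_eq_zero.1 h0]
      have := mul_pos hη (hεl l hl)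
      linarith
  obtain ⟨t, ⟨⟨⟨⟨⟨h_comm, h_flow⟩, h_wired⟩, h_power⟩, h_good⟩, (ht : 0 < t)⟩⟩ :=
    ((((((eventually_all.2 e_comm).and (eventually_all.2 fun l => eventually_all.2 (e_flow l))).and
      (eventually_all.2 e_wired)).and (eventually_all.2 e_power)).and
      (eventually_all.2 e_good)).and self_mem_nhdsWithin).exists
  have hlt : minRate y < minRate (y + t • v) := by
    rw [minRate_add_smul, hvr]
    linarith [mul_pos ht hηd]
  have hpz : ∀ l, precoder y l = 0 → precoder (y + t • v) l = 0 := fun l hl => by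
    rw [precoder_add_smul, hl, hvp l hl, smul_zero, add_zero]
  refine ⟨y + t • v, ⟨hy.1.minRate_nonneg.trans hlt.le, fun m => ?_, h_flow, fun l => ?_,
    fun s => ?_, fun n m => ?_⟩, hlt, fun s hs => sub_pos.1 (h_power s hs), hpz,
    fun l hl => e_bad l hl t ht, fun l hl => sub_pos.1 (h_good l hl)⟩
  · rw [minRate_add_smul, commRate_add_smul]
    linarith [h_comm m]
  · rw [load_add_smul]
    linarith [h_wired l]
  · rcases (N.power_nonneg s).lt_or_eq with hs | hs
    · exact (sub_pos.1 (h_power s hs)).le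
    -- A station with zero budget has only zero precoders in `y`, and the masked direction keeps
    -- them so.
    · rw [← hs]
      refine (usedPower_eq_zero fun l hl => hpz l (precoder_eq_zero_of_power hy ?_)).le
      rw [hl, hs]
  · have h1 : N.excessL n m y = 0 := by rw [excessL_apply, hy.1.conservation, sub_self]
    have h2 : N.excessL n m v = N.excessL n m d - η * N.excessL n m y := by
      simp only [excessL, sub_apply, add_apply, _root_.sum_apply, flowL_apply, hvf,
        Finset.sum_sub_distrib, ← Finset.mul_sum]
      split_ifs <;> simp only [commRateL_apply, zero_apply, hvc] <;> ring
    have h3 : N.excessL n m (y + t • v) = 0 := by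
      rw [map_add, map_smul, h2, h1, hcons, mul_zero, sub_zero, smul_zero, add_zero]
    rw [excessL_apply] at h3
    exact sub_eq_zero.1 h3

/-- A feasible point that is not stationary can be improved. -/
lemma exists_improves [Fintype R] [Fintype B] [Fintype U] {y : N.Var} (hy : y ∈ N.mainFeasible)
    (hn : ¬ N.IsKKT y) : ∃ x : N.Var, Improves x y := by
  classical
  rcases exists_multipliers_or_direction (Finset.univ.filter fun i => N.ineq y i = 0) (N.ineqL y)
    (fun j : Node R B U × Fin M => N.excessL j.1 j.2) N.minRateL with ⟨c, e, hc, h⟩ | ⟨d, h1, h2, h3⟩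
  · exact absurd (N.isKKT_of_multipliers hy c e hc (by convert h)) hn
  · exact exists_improves_of_direction hy h1 (fun i hi => h2 i (by simpa using hi))
      fun v m => h3 (v, m)

end Direction

/-! ### Transfer of an improvement to nearby subproblems -/

section Perturbation

variable (N : HetNet R B U K M)

/-- If `q l` is small, then any precoders `p` with `p l` in the phase of `q l` are compatible with a
vanishing load of `l` in the problem given by `q`. -/
lemma rateMSE_update_nonneg {q p : N.WirelessLink → ℂ} {l : N.WirelessLink} {ρ : ℝ}
    (hp : p l = ρ * (q l / ‖q l‖))
    (h : ‖q l‖ * (1 + N.received p l / N.noise (user l)) ≤ 2 * ρ) :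
    0 ≤ N.rateMSE (N.updateU q) (N.updateW q (N.updateU q)) p l := by
  by_cases h0 : N.chan l l * q l = 0
  · rw [N.rateMSE_update_eq_zero q p l h0]
  have hq : 0 < ‖q l‖ := norm_pos_iff.2 (right_ne_zero_of_mul h0)
  have hJ := N.received_pos q l
  have hD := N.disturbance_pos q l
  have hT := N.received_pos p l
  have hσ := N.noise_pos (user l)
  have hσD := N.noise_le_disturbance q l
  have hJD := N.received_eq q l
  have hu : (star (N.updateU q l) * (N.chan l l * p l)).re =
      ‖N.chan l l‖ ^ 2 * ‖q l‖ * ρ / N.received q l := by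
    have : star (N.updateU q l) * (N.chan l l * p l) =
        ((‖N.chan l l‖ ^ 2 * ‖q l‖ * ρ / N.received q l : ℝ) : ℂ) := by
      have h1 : (starRingEnd ℂ) (N.chan l l) * N.chan l l = (‖N.chan l l‖ : ℂ) ^ 2 :=
        Complex.conj_mul' _
      have h2 : (starRingEnd ℂ) (q l) * q l = (‖q l‖ : ℂ) ^ 2 := Complex.conj_mul' _
      have h3 : (‖q l‖ : ℂ) ≠ 0 := by exact_mod_cast hq.ne'
      have h4 : (N.received q l : ℂ) ≠ 0 := by exact_mod_cast hJ.ne'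
      rw [updateU_eq, hp]
      simp only [RCLike.star_def, map_mul, Complex.conj_ofReal]
      push_cast
      field_simp
      calc _ = ((starRingEnd ℂ) (N.chan l l) * N.chan l l) * ((starRingEnd ℂ) (q l) * q l) * ρ := by
            ring
        _ = _ := by rw [h1, h2]; ring
    rw [this, Complex.ofReal_re]
  -- Bounding the logarithm by `1 - D / J` reduces the claim to a rational inequality, which after
  -- multiplication by `D * J` reads `a ^ 2 + a * T ≤ 2 * (b ^ 2 * c * ρ) * J`, since `J - D = a`.
  have hlog := Real.one_sub_inv_le_log_of_pos (div_pos hJ hD)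
  rw [rateMSE_eq, hu, updateW_updateU, norm_updateU_sq]
  rw [inv_div] at hlog
  have hsig : N.signal q l = ‖N.chan l l‖ ^ 2 * ‖q l‖ ^ 2 := rfl
  generalize N.received q l = J at *
  generalize N.disturbance q l = D at *
  generalize N.received p l = T at *
  generalize N.noise (user l) = σ at *
  generalize N.signal q l = a at *
  generalize ‖N.chan l l‖ = b at *
  generalize ‖q l‖ = c at *
  have ha : 0 ≤ a := hsig ▸ by positivity
  -- Here `a ≤ J`, and `T ≤ T / σ * J` because `σ ≤ D ≤ J`; then `h` applies.
  have key : c * (a + T) ≤ 2 * ρ * J := by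
    have h1 : T ≤ T / σ * J := by
      rw [div_mul_eq_mul_div, le_div_iff₀ hσ]
      exact mul_le_mul_of_nonneg_left (by linarith) hT.le
    calc c * (a + T) ≤ c * (J + T / σ * J) := by gcongr; linarith
      _ = c * (1 + T / σ) * J := by ring
      _ ≤ _ := by gcongr
  have key2 : a ^ 2 + a * T ≤ 2 * (b ^ 2 * c * ρ) * J := by
    have := mul_le_mul_of_nonneg_left key (by positivity : 0 ≤ b ^ 2 * c)
    rw [hsig] at this ⊢
    linarith
  have hfin : J / D * (1 - 2 * (b ^ 2 * c * ρ / J) + a / J ^ 2 * T) ≤ 1 + (1 - D / J) := by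
    have e1 : J / D * (1 - 2 * (b ^ 2 * c * ρ / J) + a / J ^ 2 * T) =
        (J ^ 2 - 2 * (b ^ 2 * c * ρ) * J + a * T) / (D * J) := by
      field_simp
    have e2 : 1 + (1 - D / J) = (2 * D * J - D ^ 2) / (D * J) := by
      field_simp
      ring
    rw [e1, e2]
    gcongr
    have : D = J - a := by linarith
    rw [this]
    linarith
  linarith

lemma received_add_le (p r : N.WirelessLink → ℂ) (hr : ‖r‖ ≤ 1) (l : N.WirelessLink) :
    N.received (p + r) l ≤
      ∑ n ∈ N.interferers l, ‖N.chan l n‖ ^ 2 * (‖p n‖ + 1) ^ 2 + N.noise (user l) := by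
  unfold received
  gcongr with n _
  exact (norm_add_le _ _).trans (by gcongr; exact (norm_le_pi_norm r n).trans hr)

variable {N}

/-- The updates depend continuously on the precoders because the noise keeps all denominators
positive, so strict inequalities persist when both arguments move. -/
lemma Improves.eventually_strict [Finite B] {x y : N.Var} (hx : Improves x y) :
    ∀ᶠ a : (N.WirelessLink → ℂ) × (N.WirelessLink → ℂ) in 𝓝 (precoder y, precoder x),
      (∀ s, 0 < N.power s → N.usedPower a.2 s < N.power s) ∧
      ∀ l : N.WirelessLink, N.chan l l * precoder y l ≠ 0 → load x (Sum.inr l) <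
        N.rateMSE (N.updateU a.1) (N.updateW a.1 (N.updateU a.1)) a.2 l := by
  refine (eventually_all.2 fun s => ?_).and (eventually_all.2 fun l => ?_)
  · by_cases hs : 0 < N.power s
    · have hc : Continuous fun a : (N.WirelessLink → ℂ) × (N.WirelessLink → ℂ) =>
        N.usedPower a.2 s := (N.continuous_usedPower s).comp continuous_snd
      have := (hc.tendsto (precoder y, precoder x)).eventually (gt_mem_nhds (hx.power_lt s hs))
      exact this.mono fun _ h _ => h
    · exact Eventually.of_forall fun _ h => absurd h hs
  · by_cases hl : N.chan l l * precoder y l = 0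
    · exact Eventually.of_forall fun _ h => absurd hl h
    · have := ((N.continuous_rateMSE_update l).tendsto (precoder y, precoder x)).eventually
        (lt_mem_nhds (hx.load_lt l hl))
      exact this.mono fun _ h _ => h

/-- An improvement of `y` yields, for all feasible points near `y`, comparable points in the
problem that the algorithm solves next. -/
lemma Improves.eventually_exists_subFeasible [Finite B] {x y : N.Var} (hx : Improves x y) :
    ∀ᶠ z in 𝓝 y, z ∈ N.mainFeasible → ∃ x' ∈ N.subFeasible (N.updateU (precoder z))
      (N.updateW (precoder z) (N.updateU (precoder z))), minRate x' = minRate x := by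
  classical
  have h1 := hx.eventually_strict
  obtain ⟨δ, hδ, h2⟩ := Metric.eventually_nhds_iff.1 h1
  -- The bound `1` makes `T` a bound of the received power that does not depend on `z`; the bound `δ
  -- / 2` keeps the perturbed precoders where the strict inequalities hold.
  set ρ : ℝ := min 1 (δ / 2) with hρ
  have hρ0 : 0 < ρ := lt_min one_pos (half_pos hδ)
  set T : N.WirelessLink → ℝ := fun l =>
    ∑ n ∈ N.interferers l, ‖N.chan l n‖ ^ 2 * (‖precoder x n‖ + 1) ^ 2 + N.noise (user l)
  have h3 : ∀ᶠ z in 𝓝 y, ∀ l, precoder y l = 0 →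
      ‖precoder z l‖ * (1 + T l / N.noise (user l)) < 2 * ρ := by
    refine eventually_all.2 fun l => ?_
    by_cases hl : precoder y l = 0
    · have hc : ContinuousAt
          (fun z : N.Var => ‖precoder z l‖ * (1 + T l / N.noise (user l))) y :=
        (((continuous_apply l).comp N.continuous_precoder).norm.mul continuous_const).continuousAt
      have hlt : ‖precoder y l‖ * (1 + T l / N.noise (user l)) < 2 * ρ := by
        rw [hl, norm_zero, zero_mul]
        linarith
      have := Filter.Tendsto.eventually hc (gt_mem_nhds hlt)
      exact this.mono fun _ h _ => h
    · exact Eventually.of_forall fun _ h => absurd h hl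
  have h4 : ∀ᶠ z in 𝓝 y, dist (precoder z) (precoder y) < δ :=
    N.continuous_precoder.continuousAt.eventually (Metric.ball_mem_nhds _ hδ)
  filter_upwards [h3, h4] with z hz3 hz4 hz
  -- If `precoder z l = 0`, division by zero makes this entry zero; this is harmless because the
  -- minorant of `l` is then identically zero.
  set r : N.WirelessLink → ℂ := fun l =>
    if precoder y l = 0 then ρ * (precoder z l / ‖precoder z l‖) else 0 with hr
  have hrρ : ‖r‖ ≤ ρ := by
    refine (pi_norm_le_iff_of_nonneg hρ0.le).2 fun l => ?_
    simp only [hr]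
    split_ifs
    · rw [norm_mul, Complex.norm_real, Real.norm_of_nonneg hρ0.le, norm_div, Complex.norm_real,
        norm_norm]
      exact mul_le_of_le_one_right hρ0.le (div_self_le_one _)
    · rw [norm_zero]
      exact hρ0.le
  have hr1 : ‖r‖ ≤ 1 := hrρ.trans (min_le_left _ _)
  obtain ⟨hpow, hgood⟩ := h2 (y := (precoder z, precoder x + r)) (by
    rw [Prod.dist_eq, max_lt_iff]
    refine ⟨hz4, ?_⟩
    rw [dist_eq_norm, add_sub_cancel_left]
    exact (hrρ.trans (min_le_right _ _)).trans_lt (half_lt_self hδ))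
  refine ⟨(minRate x, commRate x, flow x, precoder x + r), ⟨⟨hx.base.minRate_nonneg,
    hx.base.minRate_le, hx.base.flow_nonneg, hx.base.wired_cap, fun s => ?_,
    hx.base.conservation⟩, fun l => ?_⟩, rfl⟩
  · change N.usedPower (precoder x + r) s ≤ N.power s
    rcases (N.power_nonneg s).lt_or_eq with hs | hs
    · exact (hpow s hs).le
    · rw [← hs]
      refine (usedPower_eq_zero fun l hl => ?_).le
      have hpl : N.power (bs l) = 0 := by rw [hl, hs]
      have hxl : precoder x l = 0 := by
        have := (N.norm_sq_le_usedPower (precoder x) l).trans (hx.base.power_le _)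
        rw [hpl] at this
        simpa using this
      simp [hr, hxl, precoder_eq_zero_of_power hz hpl]
  · change load x (Sum.inr l) ≤ N.rateMSE _ _ (precoder x + r) l
    -- Without signal at `y` the load is at most zero, so only a nonnegative minorant is needed: it
    -- is identically zero if the channel vanishes, and otherwise the phase-aligned perturbation
    -- ensures it.
    by_cases hl : N.chan l l * precoder y l = 0
    · refine (hx.load_le_zero l hl).trans ?_
      rcases mul_eq_zero.1 hl with hc | hyl
      · rw [N.rateMSE_update_eq_zero _ _ l (by rw [hc, zero_mul])]
      · refine N.rateMSE_update_nonneg (ρ := ρ) ?_ (le_trans ?_ (hz3 l hyl).le)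
        · simp [hr, hyl, hx.precoder_eq_zero l hyl]
        · have := N.received_add_le (precoder x) r hr1 l
          have := N.noise_pos (user l)
          gcongr
    · exact (hgood l hl).le

end Perturbation

/-! ### Convergence of the algorithm -/

section Convergence

variable {N : HetNet R B U K M} {x : ℕ → N.Var} {u : ℕ → N.WirelessLink → ℂ}
  {w : ℕ → N.WirelessLink → ℝ}

lemma IsNMaxMinRun.mem_mainFeasible (h : N.IsNMaxMinRun x u w) (t : ℕ) :
    x t ∈ N.mainFeasible := by
  cases t with
  | zero => exact h.init
  | succ t =>
    refine N.subFeasible_subset_mainFeasible _ (fun l => ?_) (h.x_feasible t)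
    rw [h.w_step, h.u_step]
    exact N.updateW_updateU_pos _ l

lemma IsNMaxMinRun.minRate_le_of_mem_subFeasible (h : N.IsNMaxMinRun x u w) (t : ℕ) {z : N.Var}
    (hz : z ∈ N.subFeasible (N.updateU (precoder (x t)))
      (N.updateW (precoder (x t)) (N.updateU (precoder (x t))))) :
    minRate z ≤ minRate (x (t + 1)) := by
  refine h.x_optimal t ?_
  rwa [h.w_step, h.u_step]

lemma IsNMaxMinRun.monotone_minRate (h : N.IsNMaxMinRun x u w) :
    Monotone fun t => minRate (x t) :=
  monotone_nat_of_le_succ fun t =>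
    h.minRate_le_of_mem_subFeasible t (N.mem_subFeasible_update (h.mem_mainFeasible t))

lemma IsNMaxMinRun.exists_tendsto_minRate (h : N.IsNMaxMinRun x u w) (hM : 1 ≤ M) :
    ∃ r, Tendsto (fun t => minRate (x t)) atTop (𝓝 r) := by
  obtain ⟨b, hb⟩ := ((N.isCompact_mainFeasible hM).image N.continuous_minRate).bddAbove
  exact ⟨_, tendsto_atTop_ciSup h.monotone_minRate
    ⟨b, by rintro _ ⟨t, rfl⟩; exact hb ⟨_, h.mem_mainFeasible t, rfl⟩⟩⟩

lemma IsNMaxMinRun.isKKT_of_mapClusterPt [Fintype R] [Fintype B] [Fintype U]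
    (h : N.IsNMaxMinRun x u w) (hM : 1 ≤ M) {y : N.Var} (hy : MapClusterPt y atTop x) :
    N.IsKKT y := by
  obtain ⟨r, hr⟩ := h.exists_tendsto_minRate hM
  obtain ⟨φ, hφ, hφy⟩ := hy.tendsto_subseq
  have hyF : y ∈ N.mainFeasible := N.isClosed_mainFeasible.mem_of_tendsto hφy
    (Eventually.of_forall fun t => h.mem_mainFeasible (φ t))
  have hyr : minRate y = r := tendsto_nhds_unique
    ((N.continuous_minRate.tendsto y).comp hφy) (hr.comp hφ.tendsto_atTop)
  by_contra hn
  obtain ⟨x', hx'⟩ := exists_improves hyF hn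
  -- Some iterate is close enough to `y` for its subproblem to contain a point with the objective
  -- value of `x'`; the next iterate does at least as well and exceeds the limit `r = minRate y`.
  obtain ⟨t, ht⟩ := (hy.frequently hx'.eventually_exists_subFeasible).exists
  obtain ⟨z, hz, hzr⟩ := ht (h.mem_mainFeasible t)
  have h1 := h.minRate_le_of_mem_subFeasible t hz
  have h2 := h.monotone_minRate.ge_of_tendsto hr (t + 1)
  have h3 := hx'.lt
  linarith

/-- Iterates that stay away from the stationary points would, by compactness, have a limit point,
which is stationary. -/
lemma IsNMaxMinRun.tendsto_infEDist [Fintype R] [Fintype B] [Fintype U]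
    (h : N.IsNMaxMinRun x u w) (hM : 1 ≤ M) :
    Tendsto (fun t => Metric.infEDist (x t) {y | N.IsKKT y}) atTop (𝓝 0) := by
  refine ENNReal.tendsto_nhds_zero.2 fun ε hε => ?_
  by_contra hcon
  rw [not_eventually] at hcon
  obtain ⟨φ, hφ, hφε⟩ := extraction_of_frequently_atTop hcon
  obtain ⟨y, -, ψ, hψ, hy⟩ := (N.isCompact_mainFeasible hM).tendsto_subseq
    fun t => h.mem_mainFeasible (φ t)
  have hyK : N.IsKKT y := h.isKKT_of_mapClusterPt hM
    (hy.mapClusterPt.of_comp (hφ.comp hψ).tendsto_atTop)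
  have h1 := (Metric.continuous_infEDist (s := {y | N.IsKKT y})).tendsto y |>.comp hy
  rw [Metric.infEDist_zero_of_mem (show y ∈ {y | N.IsKKT y} from hyK)] at h1
  obtain ⟨t, ht⟩ := (h1.eventually (gt_mem_nhds hε)).exists
  exact hφε (ψ t) ht.le

lemma IsNMaxMinRun.isBounded_range (h : N.IsNMaxMinRun x u w) (hM : 1 ≤ M) :
    Bornology.IsBounded (Set.range x) :=
  (N.isCompact_mainFeasible hM).isBounded.subset
    (Set.range_subset_iff.2 h.mem_mainFeasible)

end Convergence

end HetNet

theorem theorem1 {R B U : Type*} [Fintype R] [Fintype B] [Fintype U] {K M : ℕ} (hM : 1 ≤ M)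
    (N : HetNet R B U K M) :
    -- convergence of the iterates to stationary points
    (∀ (x : ℕ → N.Var) (u : ℕ → N.WirelessLink → ℂ) (w : ℕ → N.WirelessLink → ℝ),
      N.IsNMaxMinRun x u w →
        Bornology.IsBounded (Set.range x) ∧
        (∃ r : ℝ, Filter.Tendsto (fun t => HetNet.minRate (x t)) Filter.atTop (nhds r)) ∧
        (∀ y : N.Var, MapClusterPt y Filter.atTop x → N.IsKKT y) ∧
        Filter.Tendsto (fun t => Metric.infEDist (x t) {y | N.IsKKT y}) Filter.atTop (nhds 0)) ∧
    -- global optima of the two problems correspond to each other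
    (∀ x : N.Var, N.IsMainOptimal x →
      N.IsMSEOptimal (x, N.updateU (HetNet.precoder x),
        N.updateW (HetNet.precoder x) (N.updateU (HetNet.precoder x)))) ∧
    (∀ z : N.VarMSE, N.IsMSEOptimal z → N.IsMainOptimal z.1) ∧
    -- the two problems have the same optimal value
    (∃ v : ℝ, IsGreatest (HetNet.minRate '' N.mainFeasible) v ∧
      IsGreatest (HetNet.mseObjective '' N.mseFeasible) v) := by
  refine ⟨fun x u w h => ⟨h.isBounded_range hM, h.exists_tendsto_minRate hM,
    fun y hy => h.isKKT_of_mapClusterPt hM hy, h.tendsto_infEDist hM⟩,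
    fun x hx => hx.isMSEOptimal, fun z hz => hz.isMainOptimal, N.exists_isGreatest hM⟩
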